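/- Let $\mathrm{Ai},\mathrm{Bi}$ be the Airy functions, and for $a>0$ and integers $k\ge 0$ let $$I_k(a)=\int_0^\infty \frac{\mathrm{Ai}(x)}{(x+a)^k}\,dx .$$ These integrals converge absolutely, and for all $a>0$ and all integers $k\ge 0$ the following hold. 1. (Recurrence) $$I_k(a)-a\,I_{k+1}(a)-(k+1)(k+2)\,I_{k+3}(a)=-\frac{\mathrm{Ai}'(0)}{a^{k+1}}-\frac{(k+1)\,\mathrm{Ai}(0)}{a^{k+2}} .$$ 2. $I_{k+1}$ is twice differentiable on $(0,\infty)$, with $I_{k+1}'(a)=-(k+1)I_{k+2}(a)$ and $I_{k+1}''(a)=(k+1)(k+2)I_{k+3}(a)$. Hence $$I_{k+1}''(a)+a\,I_{k+1}(a)=I_k(a)+\frac{\mathrm{Ai}'(0)}{a^{k+1}}+\frac{(k+1)\,\mathrm{Ai}(0)}{a^{k+2}} .$$ 3. $I_0(a)=\tfrac13$, and therefore $$I_1''(a)+a\,I_1(a)=\frac13+\frac{\mathrm{Ai}'(0)}{a}+\frac{\mathrm{Ai}(0)}{a^2}.$$ 4. (Variation of parameters) For all $a,a_0>0$, with $r(z)=-\frac{3^{1/6}}{2}\frac{\Gamma(2/3)}{z}+\frac{\pi}{3^{2/3}\Gamma(2/3)\,z^2}$,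 $$\begin{aligned} I_1(a)={}&\pi I_1(a_0)\left[\mathrm{Ai}(-a)\mathrm{Bi}'(-a_0)-\mathrm{Bi}(-a)\mathrm{Ai}'(-a_0)\right]-\pi I_2(a_0)\left[\mathrm{Ai}(-a)\mathrm{Bi}(-a_0)-\mathrm{Bi}(-a)\mathrm{Ai}(-a_0)\right]\\ &+\frac{\pi}{3}\left\{\mathrm{Ai}(-a)\int_{a_0}^a\mathrm{Bi}(-z)\,dz-\mathrm{Bi}(-a)\int_{a_0}^a\mathrm{Ai}(-z)\,dz\right\}\\ &+\mathrm{Ai}(-a)\int_{a_0}^a r(z)\,\mathrm{Bi}(-z)\,dz-\mathrm{Bi}(-a)\int_{a_0}^a r(z)\,\mathrm{Ai}(-z)\,dz .\end{aligned}$$ 5. (Closed form) Put $J_\pm(a)=\sqrt3\,\mathrm{Ai}(-a)\pm\mathrm{Bi}(-a)$ and $J'_\pm(a)=\sqrt3\,\mathrm{Ai}'(-a)\pm\mathrm{Bi}'(-a)$ (that is, $\mathrm{Ai}'$ and $\mathrm{Bi}'$ evaluated at $-a$), and, with ${}_pF_q(\alpha_1,\dots,\alpha_p;\beta_1,\dots,\beta_q;w)=\sum_{n\ge0}\frac{(\alpha_1)_n\cdots(\alpha_p)_n}{(\beta_1)_n\cdots(\beta_q)_n}\frac{w^n}{n!}$,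 $$\begin{aligned} H_+(a)={}&\tfrac{3^{1/3}\Gamma(2/3)^2}{4\pi}\,a\;{}_1F_2\!\left(\tfrac13;\tfrac43,\tfrac43;-\tfrac{a^3}{9}\right)-\tfrac{\Gamma(2/3)}{4\cdot 3^{5/6}}\,a^2\;{}_1F_2\!\left(\tfrac23;\tfrac43,\tfrac53;-\tfrac{a^3}{9}\right)+\tfrac{\sqrt3}{216}\,a^3\;{}_2F_3\!\left(1,1;2,2,\tfrac73;-\tfrac{a^3}{9}\right),\\ H_-(a)={}&-\tfrac{\pi}{3^{4/3}\Gamma(2/3)^2}\,\tfrac1a\;{}_1F_2\!\left(-\tfrac13;\tfrac23,\tfrac23;-\tfrac{a^3}{9}\right)+\tfrac{\Gamma(1/3)}{2\cdot 3^{7/6}}\,a\;{}_1F_2\!\left(\tfrac13;\tfrac23,\tfrac43;-\tfrac{a^3}{9}\right)+\tfrac{\sqrt3}{108}\,a^3\;{}_2F_3\!\left(1,1;2,2,\tfrac53;-\tfrac{a^3}{9}\right). \end{aligned}$$ Then for all $a,a_0>0$, $$\begin{aligned} I_1(a)={}&\frac{\pi}{2\sqrt3}\,I_1(a_0)\left[J_-(a)J'_+(a_0)-J_+(a)J'_-(a_0)\right]-\frac{\pi}{2\sqrt3}\,I_2(a_0)\left[J_-(a)J_+(a_0)-J_+(a)J_-(a_0)\right]\\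 &+J_+(a)\left[H_+(a)-H_+(a_0)\right]+J_-(a)\left[H_-(a)-H_-(a_0)\right]-\mathrm{Ai}(-a)\left[\ln a-\ln a_0\right].\end{aligned}$$ -/

import Mathlib

open MeasureTheory Set

noncomputable section

/-- The value `Ai(0) = 3^(-2/3) / Γ(2/3)`. -/
def airyC₁ : ℝ := (3 : ℝ) ^ (-(2 / 3) : ℝ) / Real.Gamma (2 / 3)

/-- The value `-Ai'(0) = 3^(-1/3) / Γ(1/3)`. -/
def airyC₂ : ℝ := (3 : ℝ) ^ (-(1 / 3) : ℝ) / Real.Gamma (1 / 3)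

/-- The solution of `y'' = x y` with `y(0) = 1`, `y'(0) = 0`, by its (everywhere convergent)
Maclaurin series `∑ 3^n (1/3)_n x^(3n) / (3n)!`, where `(c)_n` is the rising factorial. -/
def airyF (x : ℝ) : ℝ :=
  ∑' n : ℕ, 3 ^ n * (ascPochhammer ℝ n).eval (1 / 3) * x ^ (3 * n) / ((3 * n).factorial : ℝ)

/-- The solution of `y'' = x y` with `y(0) = 0`, `y'(0) = 1`, by its (everywhere convergent)
Maclaurin series `∑ 3^n (2/3)_n x^(3n+1) / (3n+1)!`. -/
def airyG (x : ℝ) : ℝ :=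
  ∑' n : ℕ, 3 ^ n * (ascPochhammer ℝ n).eval (2 / 3) * x ^ (3 * n + 1) /
    ((3 * n + 1).factorial : ℝ)

/-- The Airy function `Ai` on the real line. -/
def airyAi (x : ℝ) : ℝ := airyC₁ * airyF x - airyC₂ * airyG x

/-- The Airy function `Bi` on the real line. -/
def airyBi (x : ℝ) : ℝ := √3 * (airyC₁ * airyF x + airyC₂ * airyG x)

/-- The generalized hypergeometric function `pFq(as; bs; z) = ∑ (∏ (a)_n / ∏ (b)_n) z^n / n!`
for real parameters and real argument. -/
def hypergeometricPFQ (as bs : List ℝ) (z : ℝ) : ℝ :=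
  ∑' n : ℕ, (as.map fun a => (ascPochhammer ℝ n).eval a).prod /
    (bs.map fun b => (ascPochhammer ℝ n).eval b).prod * z ^ n / (n.factorial : ℝ)

/-- The generalized Stieltjes transform `I_k(a) = ∫_0^∞ Ai(x) / (x + a)^k dx`. -/
def airyStieltjes (k : ℕ) (a : ℝ) : ℝ := ∫ x in Ioi (0 : ℝ), airyAi x / (x + a) ^ k

/-- `J_+(a) = √3 Ai(-a) + Bi(-a)`. -/
def airyJPlus (a : ℝ) : ℝ := √3 * airyAi (-a) + airyBi (-a)

/-- `J_-(a) = √3 Ai(-a) - Bi(-a)`. -/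
def airyJMinus (a : ℝ) : ℝ := √3 * airyAi (-a) - airyBi (-a)

/-- `J'_+(a) = √3 Ai'(-a) + Bi'(-a)` (the derivatives of `Ai`, `Bi` evaluated at `-a`). -/
def airyJPlus' (a : ℝ) : ℝ := √3 * deriv airyAi (-a) + deriv airyBi (-a)

/-- `J'_-(a) = √3 Ai'(-a) - Bi'(-a)` (the derivatives of `Ai`, `Bi` evaluated at `-a`). -/
def airyJMinus' (a : ℝ) : ℝ := √3 * deriv airyAi (-a) - deriv airyBi (-a)

/-- The function `H_+` of the closed form. -/
def airyHPlus (a : ℝ) : ℝ :=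
  (3 : ℝ) ^ (1 / 3 : ℝ) * Real.Gamma (2 / 3) ^ 2 / (4 * Real.pi) * a *
      hypergeometricPFQ [1 / 3] [4 / 3, 4 / 3] (-a ^ 3 / 9)
    - Real.Gamma (2 / 3) / ((3 : ℝ) ^ (5 / 6 : ℝ) * 4) * a ^ 2 *
      hypergeometricPFQ [2 / 3] [4 / 3, 5 / 3] (-a ^ 3 / 9)
    + √3 / 216 * a ^ 3 * hypergeometricPFQ [1, 1] [2, 2, 7 / 3] (-a ^ 3 / 9)

/-- The function `H_-` of the closed form. -/
def airyHMinus (a : ℝ) : ℝ :=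
  -(Real.pi / ((3 : ℝ) ^ (4 / 3 : ℝ) * Real.Gamma (2 / 3) ^ 2)) * (1 / a) *
      hypergeometricPFQ [-(1 / 3)] [2 / 3, 2 / 3] (-a ^ 3 / 9)
    + Real.Gamma (1 / 3) / ((3 : ℝ) ^ (7 / 6 : ℝ) * 2) * a *
      hypergeometricPFQ [1 / 3] [2 / 3, 4 / 3] (-a ^ 3 / 9)
    + √3 / 108 * a ^ 3 * hypergeometricPFQ [1, 1] [2, 2, 5 / 3] (-a ^ 3 / 9)

end

/-! `airyAi` is given by its Maclaurin series, which hides its behaviour at infinity. The remedy is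
the rotated contour integral Ai(x) = Im(ω ∫_0^∞ exp(-s³/3 - xωs) ds)/π with ω = e^(iπ/3): its right
side solves y'' = xy with the same initial data, and such a solution is unique by a Wronskian
argument (`airy_solution_eq`, `airyAi_eq_im`). It yields Ai = O(x⁻⁴) and Ai' = O(x⁻²). Integrating
it over [0, X] and dropping exp(-s³/3) leaves a Laplace transform of sin(qs)/s equal to arctan √3 =
π/3, up to O(X⁻³); hence I_0 = 1/3 (`integral_airyAi`).

The recurrence integrates the derivative of Ai'(x)/(x+a)^(k+1) + (k+1)Ai(x)/(x+a)^(k+2), using x =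
(x+a) - a. Combined with differentiation under the integral, it becomes the differential equation.

For y'' + ay = R and any f with f'' = xf, the quantity -y(a)f'(-a) - y'(a)f(-a) has derivative
-R(a)f(-a). Two independent f determine y (`airy_variation_of_parameters`). The pair Ai, Bi gives
the integral formula. The pair `airyF`, `airyG`, proportional to J_+ and J_- at -a, gives the closed
form: both are elementary multiples of a 0F1 series in a³, so the primitives of R(a)f(-a) come from
termwise integration, which produces the 1F2 and 2F3 series and a logarithm. -/

/-! ### Everywhere convergent power series -/

/-- The coefficients of an everywhere convergent power series. -/
def EntireCoeff (c : ℕ → ℝ) : Prop := ∀ R : ℝ, Summable fun n => c n * R ^ n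

/-- The sum of a power series. -/
noncomputable def seriesEval (c : ℕ → ℝ) (w : ℝ) : ℝ := ∑' n, c n * w ^ n

lemma EntireCoeff.abs {c : ℕ → ℝ} (h : EntireCoeff c) : EntireCoeff fun n => |c n| := by
  intro R
  have := (h R).abs
  refine Summable.of_norm_bounded this fun n => ?_
  simp [abs_mul]

lemma EntireCoeff.of_le {c d : ℕ → ℝ} (h : EntireCoeff c) (hd : ∀ n, |d n| ≤ |c n|) :
    EntireCoeff d := by
  intro R
  refine Summable.of_norm_bounded (h R).abs fun n => ?_
  rw [Real.norm_eq_abs, abs_mul, abs_mul]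
  exact mul_le_mul_of_nonneg_right (hd n) (abs_nonneg _)

lemma EntireCoeff.nat_mul {c : ℕ → ℝ} (h : EntireCoeff c) : EntireCoeff fun n => (n : ℝ) * c n := by
  intro R
  refine Summable.of_norm_bounded (h (2 * R)).abs fun n => ?_
  -- The factor n is absorbed by doubling the radius.
  have h2 : (n : ℝ) ≤ 2 ^ n := by exact_mod_cast Nat.lt_two_pow_self.le
  rw [Real.norm_eq_abs, mul_pow, abs_mul, abs_mul, abs_mul, abs_mul, Nat.abs_cast,
    abs_of_pos (by positivity : (0 : ℝ) < 2 ^ n)]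
  nlinarith [mul_le_mul_of_nonneg_right h2 (mul_nonneg (abs_nonneg (c n)) (abs_nonneg (R ^ n)))]

lemma EntireCoeff.shift {c : ℕ → ℝ} (h : EntireCoeff c) : EntireCoeff fun n => c (n + 1) := by
  intro R
  by_cases hR : R = 0
  · subst hR
    refine summable_of_ne_finset_zero (s := {0}) fun n hn => ?_
    simp only [Finset.mem_singleton] at hn
    simp [hn]
  · have := ((summable_nat_add_iff 1).2 (h R)).mul_right R⁻¹
    refine this.congr fun n => ?_
    field_simp
    ring

lemma EntireCoeff.deriv {c : ℕ → ℝ} (h : EntireCoeff c) :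
    EntireCoeff fun n => ((n : ℝ) + 1) * c (n + 1) := by
  simpa using h.nat_mul.shift

lemma EntireCoeff.hasDerivAt {c : ℕ → ℝ} (h : EntireCoeff c) (w : ℝ) :
    HasDerivAt (seriesEval c) (seriesEval (fun n => ((n : ℝ) + 1) * c (n + 1)) w) w := by
  have key : HasDerivAt (fun z => ∑' n : ℕ, c n * z ^ n) (∑' n : ℕ, c n * ((n : ℝ) * w ^ (n - 1))) w := by
    have hu : Summable fun n : ℕ => |(n : ℝ) * c n| * (|w| + 1) ^ (n - 1) := by
      refine Summable.of_norm_bounded (h.nat_mul.abs (|w| + 1)) fun n => ?_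
      rw [Real.norm_eq_abs, abs_of_nonneg (by positivity)]
      gcongr
      · linarith [abs_nonneg w]
      · omega
    refine hasDerivAt_tsum_of_isPreconnected (t := Metric.ball 0 (|w| + 1)) (y₀ := 0) hu
      Metric.isOpen_ball (convex_ball _ _).isPreconnected
      (fun n y _ => (hasDerivAt_pow n y).const_mul (c n)) ?_ ?_ (h 0) ?_
    · intro n y hy
      rw [mem_ball_zero_iff, Real.norm_eq_abs] at hy
      rw [Real.norm_eq_abs, ← mul_assoc, abs_mul, mul_comm (c n), abs_pow]
      gcongr
    · rw [Metric.mem_ball, dist_self]; positivity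
    · simp
  have hs : Summable fun n : ℕ => c n * ((n : ℝ) * w ^ (n - 1)) := by
    rw [← summable_nat_add_iff 1]
    refine (h.deriv w).congr fun n => ?_
    push_cast
    ring
  unfold seriesEval
  convert key using 1
  rw [hs.tsum_eq_zero_add]
  simp only [CharP.cast_eq_zero, zero_mul, mul_zero, zero_add]
  refine tsum_congr fun n => ?_
  push_cast
  ring

lemma seriesEval_zero (c : ℕ → ℝ) : seriesEval c 0 = c 0 := by
  unfold seriesEval
  rw [tsum_eq_single 0 fun n hn => by simp [hn]]
  simp

lemma EntireCoeff.seriesEval_eq_add {c : ℕ → ℝ} (h : EntireCoeff c) (w : ℝ) :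
    seriesEval c w = c 0 + w * seriesEval (fun n => c (n + 1)) w := by
  unfold seriesEval
  rw [(h w).tsum_eq_zero_add, ← tsum_mul_left]
  simp only [pow_zero, mul_one, pow_succ]
  congr 1
  exact tsum_congr fun n => by ring

lemma seriesEval_const_mul (c : ℕ → ℝ) (k w : ℝ) :
    seriesEval (fun n => k * c n) w = k * seriesEval c w := by
  unfold seriesEval
  rw [← tsum_mul_left]
  exact tsum_congr fun n => by ring

lemma EntireCoeff.seriesEval_add {c d : ℕ → ℝ} (hc : EntireCoeff c) (hd : EntireCoeff d) (w : ℝ) :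
    seriesEval (fun n => c n + d n) w = seriesEval c w + seriesEval d w := by
  unfold seriesEval
  rw [← (hc w).tsum_add (hd w)]
  exact tsum_congr fun n => by ring

lemma EntireCoeff.const_mul {c : ℕ → ℝ} (h : EntireCoeff c) (k : ℝ) :
    EntireCoeff fun n => k * c n := fun R =>
  ((h R).mul_left k).congr fun n => by ring

lemma EntireCoeff.mul_seriesEval_deriv {c : ℕ → ℝ} (h : EntireCoeff c) (w : ℝ) :
    w * seriesEval (fun n => ((n : ℝ) + 1) * c (n + 1)) w
      = seriesEval (fun n => (n : ℝ) * c n) w := by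
  rw [h.nat_mul.seriesEval_eq_add]
  simp

/-- The Euler operator a·d/da multiplies a^m (a³)^n by m + 3n, so checking an antiderivative of this
shape reduces to comparing coefficients. -/
lemma EntireCoeff.hasDerivAt_zpow_mul {c d : ℕ → ℝ} (h : EntireCoeff c) (m : ℤ)
    (hd : ∀ n : ℕ, ((m : ℝ) + 3 * n) * c n = d n) {a : ℝ} (ha : a ≠ 0) :
    HasDerivAt (fun a => a ^ m * seriesEval c (-a ^ 3 / 9))
      (a ^ (m - 1) * seriesEval d (-a ^ 3 / 9)) a := by
  have h1 : HasDerivAt (fun a : ℝ => -a ^ 3 / 9) (-(a ^ 2) / 3) a := by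
    refine ((hasDerivAt_pow 3 a).neg.div_const 9).congr_deriv ?_
    norm_num
    ring
  have h2 := (hasDerivAt_zpow m a (Or.inl ha)).mul ((h.hasDerivAt _).comp a h1)
  refine h2.congr_deriv ?_
  have h3 : seriesEval d (-a ^ 3 / 9) = m * seriesEval c (-a ^ 3 / 9)
      + 3 * ((-a ^ 3 / 9) * seriesEval (fun n => ((n : ℝ) + 1) * c (n + 1)) (-a ^ 3 / 9)) := by
    rw [h.mul_seriesEval_deriv, ← seriesEval_const_mul, ← seriesEval_const_mul,
      ← (h.const_mul _).seriesEval_add (h.nat_mul.const_mul _)]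
    congr 1
    funext n
    rw [← hd]
    ring
  rw [h3, zpow_sub_one₀ ha, Function.comp_apply]
  field_simp
  ring

/-- When 3 does not divide m, m + 3n is a nonzero integer, so dividing by it cannot enlarge a
coefficient. -/
lemma EntireCoeff.of_linear_mul {c d : ℕ → ℝ} (h : EntireCoeff d) (m : ℤ) (hm : ¬ (3 : ℤ) ∣ m)
    (hd : ∀ n : ℕ, ((m : ℝ) + 3 * n) * c n = d n) : EntireCoeff c := by
  refine h.of_le fun n => ?_
  rw [← hd, abs_mul]
  have h1 : (1 : ℤ) ≤ |m + 3 * n| := Int.one_le_abs (by omega)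
  have h2 : (1 : ℝ) ≤ |(m : ℝ) + 3 * n| := by exact_mod_cast h1
  exact le_mul_of_one_le_left (abs_nonneg _) h2

/-! ### Rising factorials and the series 0F1 -/

/-- The rising factorial `(b)_n`. -/
noncomputable def rising (b : ℝ) (n : ℕ) : ℝ := (ascPochhammer ℝ n).eval b

lemma rising_zero (b : ℝ) : rising b 0 = 1 := by simp [rising]

lemma rising_succ (b : ℝ) (n : ℕ) : rising b (n + 1) = rising b n * (b + n) :=
  ascPochhammer_succ_eval n b

/-- Two ways of peeling a factor off (b)_{n+1}: the last one or the first one. -/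
lemma rising_mul_add (b : ℝ) (n : ℕ) : rising b n * (b + n) = b * rising (b + 1) n := by
  induction n with
  | zero => simp [rising_zero]
  | succ n ih =>
    rw [rising_succ, ih, rising_succ]
    push_cast
    ring

lemma rising_succ' (b : ℝ) (n : ℕ) : rising b (n + 1) = b * rising (b + 1) n := by
  rw [rising_succ, rising_mul_add]

lemma rising_pos {b : ℝ} (hb : 0 < b) (n : ℕ) : 0 < rising b n := ascPochhammer_pos n b hb

lemma rising_one (n : ℕ) : rising 1 n = n.factorial := by
  rw [rising, ascPochhammer_eval_one]

lemma rising_two (n : ℕ) : rising 2 n = (n + 1).factorial := by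
  have h := rising_succ' 1 n
  rw [rising_one] at h
  norm_num at h
  exact h.symm

/-- The coefficients of the hypergeometric series `0F1(; b; w)`. -/
noncomputable def zeroFOneCoeff (b : ℝ) (n : ℕ) : ℝ := 1 / (rising b n * n.factorial)

lemma entireCoeff_zeroFOneCoeff {b : ℝ} (hb : 0 < b) : EntireCoeff (zeroFOneCoeff b) := by
  have one_le : ∀ b : ℝ, 1 ≤ b → ∀ n, 1 ≤ rising b n := by
    intro b hb n
    induction n with
    | zero => simp [rising_zero]
    | succ n ih =>
      rw [rising_succ]
      have : (1 : ℝ) ≤ b + n := by linarith [n.cast_nonneg (α := ℝ)]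
      nlinarith
  have le : ∀ n, min 1 b ≤ rising b n := by
    intro n
    cases n with
    | zero => simp [rising_zero]
    | succ n =>
      rw [rising_succ']
      have := one_le (b + 1) (by linarith) n
      exact (min_le_right _ _).trans (by nlinarith)
  have hm : 0 < min 1 b := lt_min one_pos hb
  -- Since (b)_n ≥ min(1, b), the series is dominated by a multiple of the exponential series.
  have hexp : EntireCoeff fun n => (1 / min 1 b) * (1 / (n.factorial : ℝ)) :=
    EntireCoeff.const_mul (fun R => (Real.summable_pow_div_factorial R).congr fun n => by ring) _
  refine hexp.of_le fun n => ?_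
  have hn : (0 : ℝ) < n.factorial := by positivity
  have := rising_pos hb n
  rw [zeroFOneCoeff, abs_of_pos (by positivity), abs_of_pos (by positivity), one_div_mul_one_div]
  gcongr
  exact le n

/-- The sum of the hypergeometric series `0F1(; b; w)`. -/
noncomputable def zeroFOne (b w : ℝ) : ℝ := seriesEval (zeroFOneCoeff b) w

lemma zeroFOneCoeff_succ {b : ℝ} (hb : 0 < b) (n : ℕ) :
    ((n : ℝ) + 1) * zeroFOneCoeff b (n + 1) = b⁻¹ * zeroFOneCoeff (b + 1) n := by
  have h1 := rising_pos (by linarith : 0 < b + 1) n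
  rw [zeroFOneCoeff, zeroFOneCoeff, rising_succ', Nat.factorial_succ]
  push_cast
  field_simp

lemma hasDerivAt_zeroFOne {b : ℝ} (hb : 0 < b) (w : ℝ) :
    HasDerivAt (zeroFOne b) (b⁻¹ * zeroFOne (b + 1) w) w := by
  refine ((entireCoeff_zeroFOneCoeff hb).hasDerivAt w).congr_deriv ?_
  rw [zeroFOne, ← seriesEval_const_mul]
  congr 1
  funext n
  exact zeroFOneCoeff_succ hb n

lemma zeroFOne_zero (b : ℝ) : zeroFOne b 0 = 1 := by
  rw [zeroFOne, seriesEval_zero, zeroFOneCoeff, rising_zero]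
  simp

/-- The contiguous relation equivalent to `w φ'' + b φ' = φ` for `φ = 0F1(; b; w)`. -/
lemma zeroFOne_contiguous {b : ℝ} (hb : 0 < b) (w : ℝ) :
    w * ((b * (b + 1))⁻¹ * zeroFOne (b + 2) w) + zeroFOne (b + 1) w = zeroFOne b w := by
  have hb1 : 0 < b + 1 := by linarith
  have h1 : (b + 1)⁻¹ * zeroFOne (b + 2) w
      = seriesEval (fun n => ((n : ℝ) + 1) * zeroFOneCoeff (b + 1) (n + 1)) w := by
    rw [zeroFOne, ← seriesEval_const_mul]
    congr 1
    funext n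
    rw [zeroFOneCoeff_succ hb1]
    ring_nf
  -- The operator w·d/dw multiplies the n-th coefficient by n; the relation then becomes (b +
  -- n)(b)_n = b (b+1)_n coefficientwise.
  have h2 := (entireCoeff_zeroFOneCoeff hb1).mul_seriesEval_deriv w
  rw [← h1] at h2
  have h3 : w * ((b * (b + 1))⁻¹ * zeroFOne (b + 2) w)
      = b⁻¹ * (w * ((b + 1)⁻¹ * zeroFOne (b + 2) w)) := by
    rw [mul_inv]; ring
  have he := entireCoeff_zeroFOneCoeff hb1
  rw [h3, h2, ← seriesEval_const_mul, zeroFOne, zeroFOne,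
    ← (he.nat_mul.const_mul _).seriesEval_add he]
  congr 1
  funext n
  have h4 := rising_mul_add b n
  have h5 := rising_pos hb n
  have h6 := rising_pos hb1 n
  have h7 : (0 : ℝ) < n.factorial := by positivity
  rw [zeroFOneCoeff, zeroFOneCoeff]
  field_simp
  linear_combination h4

/-! ### The Maclaurin series of the Airy equation as 0F1 -/

/-- The factors of (3n)! are sorted by residue modulo 3; each class contributes 3^n times a rising
factorial. -/
lemma factorial_three_mul (n : ℕ) :
    ((3 * n).factorial : ℝ) = 27 ^ n * n.factorial * rising (1 / 3) n * rising (2 / 3) n := by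
  induction n with
  | zero => simp [rising_zero]
  | succ n ih =>
    rw [show 3 * (n + 1) = 3 * n + 2 + 1 by ring, Nat.factorial_succ, Nat.factorial_succ,
      Nat.factorial_succ, rising_succ, rising_succ, Nat.factorial_succ]
    push_cast
    rw [ih]
    ring

lemma factorial_three_mul_add_one (n : ℕ) :
    ((3 * n + 1).factorial : ℝ) = 27 ^ n * n.factorial * rising (2 / 3) n * rising (4 / 3) n := by
  have h := rising_mul_add (1 / 3) n
  norm_num at h
  rw [Nat.factorial_succ]
  push_cast
  rw [factorial_three_mul]
  linear_combination 3 * (27 ^ n * n.factorial * rising (2 / 3) n) * h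

lemma airyF_eq (x : ℝ) : airyF x = zeroFOne (2 / 3) (x ^ 3 / 9) := by
  refine tsum_congr fun n => ?_
  change 3 ^ n * rising (1 / 3) n * _ / _ = _
  have h1 := rising_pos (by norm_num : (0 : ℝ) < 1 / 3) n
  have h2 := rising_pos (by norm_num : (0 : ℝ) < 2 / 3) n
  rw [factorial_three_mul, zeroFOneCoeff, div_pow, pow_mul,
    show (27 : ℝ) ^ n = 3 ^ n * 9 ^ n by rw [← mul_pow]; norm_num]
  field_simp

lemma airyG_eq (x : ℝ) : airyG x = x * zeroFOne (4 / 3) (x ^ 3 / 9) := by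
  rw [zeroFOne, seriesEval, ← tsum_mul_left]
  refine tsum_congr fun n => ?_
  change 3 ^ n * rising (2 / 3) n * _ / _ = _
  have h1 := rising_pos (by norm_num : (0 : ℝ) < 4 / 3) n
  have h2 := rising_pos (by norm_num : (0 : ℝ) < 2 / 3) n
  rw [factorial_three_mul_add_one, zeroFOneCoeff, div_pow, pow_succ x, pow_mul,
    show (27 : ℝ) ^ n = 3 ^ n * 9 ^ n by rw [← mul_pow]; norm_num]
  field_simp

lemma hasDerivAt_cube_div_nine (x : ℝ) : HasDerivAt (fun x : ℝ => x ^ 3 / 9) (x ^ 2 / 3) x := by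
  refine ((hasDerivAt_pow 3 x).div_const 9).congr_deriv ?_
  norm_num
  ring

lemma hasDerivAt_zeroFOne_cube {b : ℝ} (hb : 0 < b) (x : ℝ) :
    HasDerivAt (fun x => zeroFOne b (x ^ 3 / 9))
      (b⁻¹ * zeroFOne (b + 1) (x ^ 3 / 9) * (x ^ 2 / 3)) x :=
  (hasDerivAt_zeroFOne hb _).comp x (hasDerivAt_cube_div_nine x)

/-- The derivative of `airyF`. -/
noncomputable def airyF' (x : ℝ) : ℝ := x ^ 2 / 2 * zeroFOne (5 / 3) (x ^ 3 / 9)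

/-- The derivative of `airyG`. -/
noncomputable def airyG' (x : ℝ) : ℝ :=
  zeroFOne (4 / 3) (x ^ 3 / 9) + x ^ 3 / 4 * zeroFOne (7 / 3) (x ^ 3 / 9)

lemma hasDerivAt_airyF (x : ℝ) : HasDerivAt airyF (airyF' x) x := by
  rw [funext airyF_eq]
  refine (hasDerivAt_zeroFOne_cube (by norm_num) x).congr_deriv ?_
  rw [airyF']
  norm_num
  ring

/-- The Airy equation is the contiguous relation of 0F1, here at b = 2/3 and for `airyG` at b = 4/3.
-/
lemma hasDerivAt_airyF' (x : ℝ) : HasDerivAt airyF' (x * airyF x) x := by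
  refine (((hasDerivAt_pow 2 x).div_const 2).mul
    (hasDerivAt_zeroFOne_cube (by norm_num : (0 : ℝ) < 5 / 3) x)).congr_deriv ?_
  have h := zeroFOne_contiguous (by norm_num : (0 : ℝ) < 2 / 3) (x ^ 3 / 9)
  norm_num at h
  rw [airyF_eq, ← h]
  norm_num
  ring

lemma hasDerivAt_airyG (x : ℝ) : HasDerivAt airyG (airyG' x) x := by
  rw [funext airyG_eq]
  refine ((hasDerivAt_id' x).mul
    (hasDerivAt_zeroFOne_cube (by norm_num : (0 : ℝ) < 4 / 3) x)).congr_deriv ?_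
  rw [airyG']
  norm_num
  ring

lemma hasDerivAt_airyG' (x : ℝ) : HasDerivAt airyG' (x * airyG x) x := by
  refine ((hasDerivAt_zeroFOne_cube (by norm_num : (0 : ℝ) < 4 / 3) x).add
    (((hasDerivAt_pow 3 x).div_const 4).mul
    (hasDerivAt_zeroFOne_cube (by norm_num : (0 : ℝ) < 7 / 3) x))).congr_deriv ?_
  have h := zeroFOne_contiguous (by norm_num : (0 : ℝ) < 4 / 3) (x ^ 3 / 9)
  norm_num at h
  rw [airyG_eq, ← h]
  norm_num
  ring

lemma airyF_zero : airyF 0 = 1 := by simp [airyF_eq, zeroFOne_zero]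
lemma airyF'_zero : airyF' 0 = 0 := by simp [airyF']
lemma airyG_zero : airyG 0 = 0 := by simp [airyG_eq]
lemma airyG'_zero : airyG' 0 = 1 := by simp [airyG', zeroFOne_zero]

/-! ### Wronskians and uniqueness -/

/-- The Wronskian of two solutions of `y'' = x y` is constant. -/
lemma airy_wronskian {y y' z z' : ℝ → ℝ} (hy : ∀ x, HasDerivAt y (y' x) x)
    (hy' : ∀ x, HasDerivAt y' (x * y x) x) (hz : ∀ x, HasDerivAt z (z' x) x)
    (hz' : ∀ x, HasDerivAt z' (x * z x) x) (x : ℝ) :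
    y x * z' x - y' x * z x = y 0 * z' 0 - y' 0 * z 0 := by
  have h : ∀ x, HasDerivAt (fun x => y x * z' x - y' x * z x) 0 x := fun x =>
    (((hy x).mul (hz' x)).sub ((hy' x).mul (hz x))).congr_deriv (by ring)
  exact is_const_of_deriv_eq_zero (fun x => (h x).differentiableAt) (fun x => (h x).deriv) x 0

lemma airyFG_wronskian (x : ℝ) : airyF x * airyG' x - airyF' x * airyG x = 1 := by
  rw [airy_wronskian hasDerivAt_airyF hasDerivAt_airyF' hasDerivAt_airyG hasDerivAt_airyG',
    airyF_zero, airyF'_zero, airyG_zero, airyG'_zero]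
  norm_num

/-- A solution of `y'' = x y` is determined by its initial data. -/
lemma airy_solution_eq {y y' : ℝ → ℝ} (hy : ∀ x, HasDerivAt y (y' x) x)
    (hy' : ∀ x, HasDerivAt y' (x * y x) x) (x : ℝ) :
    y x = y 0 * airyF x + y' 0 * airyG x := by
  have h1 := airy_wronskian hy hy' hasDerivAt_airyF hasDerivAt_airyF' x
  have h2 := airy_wronskian hy hy' hasDerivAt_airyG hasDerivAt_airyG' x
  have h3 := airyFG_wronskian x
  rw [airyF_zero, airyF'_zero] at h1
  rw [airyG_zero, airyG'_zero] at h2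
  -- Cramer's rule: the Wronskians of y with `airyF` and `airyG` are known from the data at 0, and
  -- the determinant is 1.
  linear_combination airyF x * h2 - airyG x * h1 - y x * h3

/-! ### Ai, Bi and their constants -/

/-- The derivative of `airyAi`. -/
noncomputable def airyAi' (x : ℝ) : ℝ := airyC₁ * airyF' x - airyC₂ * airyG' x

/-- The derivative of `airyBi`. -/
noncomputable def airyBi' (x : ℝ) : ℝ := √3 * (airyC₁ * airyF' x + airyC₂ * airyG' x)

lemma hasDerivAt_airyAi (x : ℝ) : HasDerivAt airyAi (airyAi' x) x :=
  ((hasDerivAt_airyF x).const_mul _).sub ((hasDerivAt_airyG x).const_mul _)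

lemma hasDerivAt_airyAi' (x : ℝ) : HasDerivAt airyAi' (x * airyAi x) x :=
  (((hasDerivAt_airyF' x).const_mul _).sub ((hasDerivAt_airyG' x).const_mul _)).congr_deriv
    (by rw [airyAi]; ring)

lemma hasDerivAt_airyBi (x : ℝ) : HasDerivAt airyBi (airyBi' x) x :=
  (((hasDerivAt_airyF x).const_mul _).add ((hasDerivAt_airyG x).const_mul _)).const_mul _

lemma hasDerivAt_airyBi' (x : ℝ) : HasDerivAt airyBi' (x * airyBi x) x :=
  ((((hasDerivAt_airyF' x).const_mul _).add ((hasDerivAt_airyG' x).const_mul _)).const_mul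
    _).congr_deriv (by rw [airyBi]; ring)

lemma deriv_airyAi : deriv airyAi = airyAi' := funext fun x => (hasDerivAt_airyAi x).deriv

lemma deriv_airyBi : deriv airyBi = airyBi' := funext fun x => (hasDerivAt_airyBi x).deriv

lemma continuous_airyAi : Continuous airyAi :=
  continuous_iff_continuousAt.2 fun x => (hasDerivAt_airyAi x).continuousAt

lemma continuous_airyBi : Continuous airyBi :=
  continuous_iff_continuousAt.2 fun x => (hasDerivAt_airyBi x).continuousAt

lemma airyAi_zero : airyAi 0 = airyC₁ := by simp [airyAi, airyF_zero, airyG_zero]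

lemma airyAi'_zero : airyAi' 0 = -airyC₂ := by simp [airyAi', airyF'_zero, airyG'_zero]

/-- Euler's reflection formula at 1/3. -/
lemma gamma_one_third_mul : Real.Gamma (1 / 3) * Real.Gamma (2 / 3) = 2 * Real.pi / √3 := by
  have h := Real.Gamma_mul_Gamma_one_sub (1 / 3)
  rw [show (1 : ℝ) - 1 / 3 = 2 / 3 by norm_num,
    show Real.pi * (1 / 3) = Real.pi / 3 by ring, Real.sin_pi_div_three] at h
  rw [h]
  field_simp

lemma gamma_one_third_pos : 0 < Real.Gamma (1 / 3) := Real.Gamma_pos_of_pos (by norm_num)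

lemma gamma_two_thirds_pos : 0 < Real.Gamma (2 / 3) := Real.Gamma_pos_of_pos (by norm_num)

lemma gamma_one_third : Real.Gamma (1 / 3) = 2 * Real.pi / (√3 * Real.Gamma (2 / 3)) := by
  have := gamma_two_thirds_pos
  rw [eq_div_iff (by positivity)]
  have h := gamma_one_third_mul
  field_simp at h
  linear_combination h

lemma airyC_mul : airyC₁ * airyC₂ = √3 / (6 * Real.pi) := by
  rw [airyC₁, airyC₂, div_mul_div_comm, ← Real.rpow_add (by norm_num), mul_comm (Real.Gamma _),
    gamma_one_third_mul]
  norm_num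
  have := Real.pi_pos
  field_simp
  norm_num

lemma airyAi_airyBi_wronskian (x : ℝ) :
    airyAi x * airyBi' x - airyAi' x * airyBi x = 1 / Real.pi := by
  have h3 : √3 * √3 = 3 := Real.mul_self_sqrt (by norm_num)
  have hc : 2 * √3 * (airyC₁ * airyC₂) = 1 / Real.pi := by
    rw [airyC_mul]
    field_simp
    linear_combination 2 * h3
  rw [← hc, airyAi, airyBi, airyAi', airyBi']
  linear_combination 2 * √3 * airyC₁ * airyC₂ * airyFG_wronskian x

/-! ### The contour integral for Ai -/

/-- The primitive sixth root of unity `e^(iπ/3)`. -/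
noncomputable def sixthRoot : ℂ := ⟨1 / 2, √3 / 2⟩

lemma sixthRoot_sq : sixthRoot ^ 2 = sixthRoot - 1 := by
  have h : √3 * √3 = 3 := Real.mul_self_sqrt (by norm_num)
  apply Complex.ext
  · simp [sixthRoot, sq]
    linarith
  · simp [sixthRoot, sq]
    ring

/-- The integrand `s^n e^(-s³/3 - xωs)` of the contour integral for the Airy function. -/
noncomputable def airyKernel (n : ℕ) (x s : ℝ) : ℂ :=
  (s : ℂ) ^ n * Complex.exp (-(s ^ 3 / 3 + x * sixthRoot * s))

lemma norm_airyKernel (n : ℕ) (x : ℝ) {s : ℝ} (hs : 0 < s) :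
    ‖airyKernel n x s‖ = s ^ n * Real.exp (-(s ^ 3 / 3 + x * s / 2)) := by
  rw [airyKernel, norm_mul, norm_pow, Complex.norm_real, Real.norm_of_nonneg hs.le,
    Complex.norm_exp]
  congr 2
  have h : -((s : ℂ) ^ 3 / 3 + x * sixthRoot * s)
      = ((-(s ^ 3 / 3) : ℝ) : ℂ) - ((x * s : ℝ) : ℂ) * sixthRoot := by
    push_cast
    ring
  rw [h, Complex.sub_re, Complex.ofReal_re, Complex.re_ofReal_mul]
  simp only [sixthRoot]
  ring

lemma continuous_airyKernel (n : ℕ) (x : ℝ) : Continuous (airyKernel n x) := by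
  unfold airyKernel
  fun_prop

lemma exp_neg_cube_le {c s : ℝ} (hc : 0 ≤ c) (hs : 0 < s) :
    Real.exp (-(s ^ 3 / 3 - c * s)) ≤ Real.exp (2 * (c + 1) ^ 3 / 3) * Real.exp (-s) := by
  rw [← Real.exp_add]
  apply Real.exp_le_exp.2
  -- With t = c + 1, (s + 2t)(s - t)² ≥ 0 gives s³/3 ≥ t²s - 2t³/3, and t² ≥ t because t ≥ 1.
  nlinarith [mul_nonneg (by linarith : 0 ≤ s + 2 * (c + 1)) (sq_nonneg (s - (c + 1))),
    mul_nonneg hs.le (mul_nonneg hc (by linarith : 0 ≤ c + 1))]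

lemma integrableOn_pow_mul_exp_neg_mul (n : ℕ) {p : ℝ} (hp : 0 < p) :
    IntegrableOn (fun s : ℝ => s ^ n * Real.exp (-(p * s))) (Ioi 0) := by
  have h := integrableOn_rpow_mul_exp_neg_mul_rpow (s := n) (p := 1) (b := p)
    (by linarith [n.cast_nonneg (α := ℝ)]) one_pos hp
  refine h.congr_fun (fun s _ => ?_) measurableSet_Ioi
  simp

lemma integral_pow_mul_exp_neg_mul (n : ℕ) {p : ℝ} (hp : 0 < p) :
    ∫ s in Ioi (0 : ℝ), s ^ n * Real.exp (-(p * s)) = n.factorial / p ^ (n + 1) := by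
  have h := Real.integral_rpow_mul_exp_neg_mul_Ioi (a := n + 1) (r := p) (by positivity) hp
  rw [Real.Gamma_nat_eq_factorial] at h
  simp only [add_sub_cancel_right, Real.rpow_natCast] at h
  rw [h]
  norm_cast
  rw [one_div, inv_pow]
  ring

lemma integrableOn_pow_mul_exp_neg_cube (n : ℕ) {c : ℝ} (hc : 0 ≤ c) :
    IntegrableOn (fun s : ℝ => s ^ n * Real.exp (-(s ^ 3 / 3 - c * s))) (Ioi 0) := by
  have h := (integrableOn_pow_mul_exp_neg_mul n one_pos).const_mul
    (Real.exp (2 * (c + 1) ^ 3 / 3))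
  refine Integrable.mono' h (by fun_prop) ?_
  filter_upwards [ae_restrict_mem measurableSet_Ioi] with s hs
  have hs : 0 < s := hs
  rw [Real.norm_of_nonneg (by positivity), one_mul]
  have := mul_le_mul_of_nonneg_left (exp_neg_cube_le hc hs) (pow_nonneg hs.le n)
  linarith

/-- A bound uniform over |x| ≤ c, as needed to differentiate under the integral sign. -/
lemma norm_airyKernel_le (n : ℕ) {x c : ℝ} (hx : |x| ≤ c) {s : ℝ} (hs : 0 < s) :
    ‖airyKernel n x s‖ ≤ s ^ n * Real.exp (-(s ^ 3 / 3 - c * s)) := by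
  rw [norm_airyKernel n x hs]
  gcongr
  nlinarith [neg_abs_le x, abs_nonneg x]

lemma integrableOn_airyKernel (n : ℕ) (x : ℝ) : IntegrableOn (airyKernel n x) (Ioi 0) := by
  refine Integrable.mono' (integrableOn_pow_mul_exp_neg_cube n (abs_nonneg x))
    (continuous_airyKernel n x).aestronglyMeasurable ?_
  filter_upwards [ae_restrict_mem measurableSet_Ioi] with s hs
  exact norm_airyKernel_le n le_rfl hs

/-- The moments `∫ s^n e^(-s³/3 - xωs) ds` over the half line. -/
noncomputable def airyMoment (n : ℕ) (x : ℝ) : ℂ := ∫ s in Ioi (0 : ℝ), airyKernel n x s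

lemma hasDerivAt_airyMoment (n : ℕ) (x : ℝ) :
    HasDerivAt (airyMoment n) (-sixthRoot * airyMoment (n + 1) x) x := by
  have h := hasDerivAt_integral_of_dominated_loc_of_deriv_le (μ := volume.restrict (Ioi (0 : ℝ)))
    (F := airyKernel n) (F' := fun x s => -sixthRoot * airyKernel (n + 1) x s) (x₀ := x)
    (s := Metric.ball x 1)
    (bound := fun s => ‖sixthRoot‖ * (s ^ (n + 1) * Real.exp (-(s ^ 3 / 3 - (|x| + 1) * s))))
    (Metric.ball_mem_nhds x one_pos)
    (Filter.Eventually.of_forall fun y => (continuous_airyKernel n y).aestronglyMeasurable)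
    (integrableOn_airyKernel n x)
    ((continuous_airyKernel (n + 1) x).aestronglyMeasurable.const_mul _) ?_
    ((integrableOn_pow_mul_exp_neg_cube (n + 1) (by positivity)).const_mul _) ?_
  · refine h.2.congr_deriv ?_
    rw [airyMoment, ← integral_const_mul]
  · filter_upwards [ae_restrict_mem measurableSet_Ioi] with s hs y hy
    rw [norm_mul, norm_neg]
    refine mul_le_mul_of_nonneg_left (norm_airyKernel_le _ ?_ hs) (norm_nonneg _)
    rw [Metric.mem_ball, Real.dist_eq] at hy
    have := abs_sub_abs_le_abs_sub y x
    linarith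
  · refine Filter.Eventually.of_forall fun s y _ => ?_
    have h1 : HasDerivAt (fun y : ℝ => -((s : ℂ) ^ 3 / 3 + y * sixthRoot * s))
        (-(sixthRoot * s)) y := by
      have := (((Complex.ofRealCLM.hasDerivAt (x := y)).mul_const sixthRoot).mul_const
        (s : ℂ)).const_add ((s : ℂ) ^ 3 / 3)
      exact this.neg.congr_deriv (by simp)
    refine ((h1.cexp).const_mul ((s : ℂ) ^ n)).congr_deriv ?_
    rw [airyKernel, pow_succ]
    ring

/-- The left side integrates the s-derivative of -exp(-s³/3 - xωs); the 1 is the boundary term at s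
= 0. -/
lemma airyMoment_two (x : ℝ) : airyMoment 2 x + x * sixthRoot * airyMoment 0 x = 1 := by
  have hd : ∀ s ∈ Ici (0 : ℝ), HasDerivAt (fun s => -airyKernel 0 x s)
      (airyKernel 2 x s + x * sixthRoot * airyKernel 0 x s) s := by
    intro s _
    have h1 : HasDerivAt (fun s : ℝ => -((s : ℂ) ^ 3 / 3 + x * sixthRoot * s))
        (-((s : ℂ) ^ 2 + x * sixthRoot)) s := by
      have h2 := (Complex.ofRealCLM.hasDerivAt (x := s))
      have := ((h2.pow 3).div_const 3).add (h2.const_mul (x * sixthRoot))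
      refine this.neg.congr_deriv ?_
      simp
    have h3 := (h1.cexp.const_mul ((s : ℂ) ^ 0)).neg
    simp only [pow_zero, one_mul] at h3
    simp only [airyKernel, pow_zero, one_mul]
    refine h3.congr_deriv ?_
    ring
  have hi : IntegrableOn (fun s => airyKernel 2 x s + x * sixthRoot * airyKernel 0 x s) (Ioi 0) :=
    (integrableOn_airyKernel 2 x).add ((integrableOn_airyKernel 0 x).const_mul _)
  have ht : Filter.Tendsto (fun s => -airyKernel 0 x s) Filter.atTop (nhds 0) := by
    rw [← neg_zero]
    refine Filter.Tendsto.neg (squeeze_zero_norm' (a := fun s =>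
      Real.exp (2 * (|x| + 1) ^ 3 / 3) * Real.exp (-s)) ?_ ?_)
    · filter_upwards [Filter.eventually_gt_atTop 0] with s hs
      have := norm_airyKernel_le 0 (le_refl |x|) hs
      rw [pow_zero, one_mul] at this
      exact this.trans (exp_neg_cube_le (abs_nonneg x) hs)
    · simpa using Real.tendsto_exp_neg_atTop_nhds_zero.const_mul (Real.exp (2 * (|x| + 1) ^ 3 / 3))
  have h := integral_Ioi_of_hasDerivAt_of_tendsto' hd hi ht
  rw [integral_add (integrableOn_airyKernel 2 x) ((integrableOn_airyKernel 0 x).const_mul _),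
    integral_const_mul] at h
  rw [airyMoment, airyMoment, h]
  simp [airyKernel]

lemma airyMoment_zero (n : ℕ) : airyMoment n 0
    = ((3 : ℝ) ^ ((n - 2) / 3 : ℝ) * Real.Gamma ((n + 1) / 3) : ℝ) := by
  have h := integral_rpow_mul_exp_neg_mul_rpow (p := 3) (q := n) (b := 1 / 3) (by norm_num)
    (by linarith [n.cast_nonneg (α := ℝ)]) (by norm_num)
  have h2 : airyMoment n 0
      = ∫ s in Ioi (0 : ℝ), ((s ^ (n : ℝ) * Real.exp (-(1 / 3) * s ^ (3 : ℝ)) : ℝ) : ℂ) := by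
    refine setIntegral_congr_fun measurableSet_Ioi fun s hs => ?_
    rw [airyKernel]
    norm_cast
    push_cast
    simp
    ring_nf
    tauto
  rw [h2, integral_complex_ofReal, h]
  congr 2
  rw [one_div, Real.inv_rpow (by norm_num), ← Real.rpow_neg (by norm_num), neg_div, neg_neg,
    ← div_eq_mul_inv, div_eq_iff (by norm_num), ← Real.rpow_add_one (by norm_num)]
  congr 1
  ring

lemma norm_airyMoment_le (n : ℕ) {x : ℝ} (hx : 0 < x) :
    ‖airyMoment n x‖ ≤ n.factorial * 2 ^ (n + 1) / x ^ (n + 1) := by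
  have h1 : ‖airyMoment n x‖ ≤ ∫ s in Ioi (0 : ℝ), s ^ n * Real.exp (-(x / 2 * s)) := by
    refine norm_integral_le_of_norm_le (integrableOn_pow_mul_exp_neg_mul n (by positivity)) ?_
    filter_upwards [ae_restrict_mem measurableSet_Ioi] with s hs
    have hs : 0 < s := hs
    rw [norm_airyKernel n x hs]
    gcongr
    have : 0 < s ^ 3 := by positivity
    linarith
  rw [integral_pow_mul_exp_neg_mul n (by positivity)] at h1
  refine h1.trans_eq ?_
  rw [div_pow]
  field_simp

lemma hasDerivAt_im_mul_airyMoment (z : ℂ) (n : ℕ) (x : ℝ) :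
    HasDerivAt (fun x => (z * airyMoment n x).im / Real.pi)
      ((-z * sixthRoot * airyMoment (n + 1) x).im / Real.pi) x := by
  have h := ((hasDerivAt_airyMoment n x).const_mul z)
  have h2 := (Complex.imCLM.hasFDerivAt.comp_hasDerivAt x h).div_const Real.pi
  refine h2.congr_deriv ?_
  simp only [Complex.imCLM_apply]
  ring_nf

/-- As ω³ = -1, the second derivative of ω·`airyMoment 0` is xω·`airyMoment 0` - 1. The
inhomogeneity is real, so imaginary parts satisfy the homogeneous Airy equation. -/
lemma airyMoment_ode (x : ℝ) :
    (-(-sixthRoot * sixthRoot) * sixthRoot * airyMoment 2 x).im / Real.pi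
      = x * ((sixthRoot * airyMoment 0 x).im / Real.pi) := by
  have h1 : -(-sixthRoot * sixthRoot) * sixthRoot = -1 := by
    linear_combination (sixthRoot + 1) * sixthRoot_sq
  have h2 : -(-sixthRoot * sixthRoot) * sixthRoot * airyMoment 2 x
      = x * (sixthRoot * airyMoment 0 x) - 1 := by
    rw [h1]
    linear_combination -airyMoment_two x
  rw [h2, Complex.sub_im, Complex.im_ofReal_mul, Complex.one_im]
  ring

lemma sixthRoot_mul_airyMoment_zero_zero_im :
    (sixthRoot * airyMoment 0 0).im / Real.pi = airyC₁ := by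
  rw [airyMoment_zero, Complex.im_mul_ofReal, airyC₁, sixthRoot]
  norm_num
  have := gamma_two_thirds_pos
  have := Real.pi_pos
  rw [gamma_one_third]
  norm_num
  field_simp

lemma sixthRoot_mul_airyMoment_one_zero_im :
    (-sixthRoot * sixthRoot * airyMoment 1 0).im / Real.pi = -airyC₂ := by
  rw [airyMoment_zero, Complex.im_mul_ofReal, airyC₂, neg_mul, ← sq, sixthRoot_sq, sixthRoot]
  norm_num
  have := gamma_two_thirds_pos
  have := Real.pi_pos
  rw [gamma_one_third]
  field_simp

lemma airyAi_eq_im (x : ℝ) : airyAi x = (sixthRoot * airyMoment 0 x).im / Real.pi := by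
  have h := airy_solution_eq (hasDerivAt_im_mul_airyMoment sixthRoot 0)
    (fun x => (hasDerivAt_im_mul_airyMoment (-sixthRoot * sixthRoot) 1 x).congr_deriv
      (airyMoment_ode x)) x
  rw [sixthRoot_mul_airyMoment_zero_zero_im, sixthRoot_mul_airyMoment_one_zero_im] at h
  rw [h, airyAi]
  ring

lemma airyAi'_eq_im (x : ℝ) :
    airyAi' x = (-sixthRoot * sixthRoot * airyMoment 1 x).im / Real.pi := by
  have h := hasDerivAt_im_mul_airyMoment sixthRoot 0 x
  rw [← funext airyAi_eq_im] at h
  exact (hasDerivAt_airyAi x).unique h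

/-! ### Decay at infinity -/

lemma norm_sixthRoot : ‖sixthRoot‖ = 1 := by
  have h : √3 * √3 = 3 := Real.mul_self_sqrt (by norm_num)
  rw [← sq_eq_sq₀ (norm_nonneg _) zero_le_one, ← Complex.normSq_eq_norm_sq, Complex.normSq_apply,
    sixthRoot]
  linarith

lemma abs_airyAi'_le {x : ℝ} (hx : 0 < x) : |airyAi' x| ≤ 4 / x ^ 2 := by
  rw [airyAi'_eq_im, abs_div, abs_of_pos Real.pi_pos]
  have h1 := Complex.abs_im_le_norm (-sixthRoot * sixthRoot * airyMoment 1 x)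
  rw [norm_mul, norm_mul, norm_neg, norm_sixthRoot, one_mul, one_mul] at h1
  have h2 := norm_airyMoment_le 1 hx
  norm_num at h2
  exact (div_le_self (abs_nonneg _) (by linarith [Real.pi_gt_three])).trans (h1.trans h2)

/-- Estimating `airyMoment 0` directly yields only O(1/x), which is not integrable. The differential
equation expresses x·Ai(x) through `airyMoment 2`, which is O(x⁻³). -/
lemma abs_airyAi_le {x : ℝ} (hx : 0 < x) : |airyAi x| ≤ 16 / x ^ 4 := by
  have h1 := airyMoment_ode x
  rw [← airyAi_eq_im] at h1
  have h2 := Complex.abs_im_le_norm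
    (-(-sixthRoot * sixthRoot) * sixthRoot * airyMoment 2 x)
  rw [norm_mul, norm_mul, norm_neg, norm_mul, norm_neg, norm_sixthRoot, one_mul, one_mul,
    one_mul] at h2
  have h3 := norm_airyMoment_le 2 hx
  norm_num at h3
  have h4 : |x * airyAi x| ≤ 16 / x ^ 3 := by
    rw [← h1, abs_div, abs_of_pos Real.pi_pos]
    exact (div_le_self (abs_nonneg _) (by linarith [Real.pi_gt_three])).trans (h2.trans h3)
  rw [abs_mul, abs_of_pos hx, mul_comm, ← le_div_iff₀ hx] at h4
  refine h4.trans_eq ?_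
  field_simp

lemma integrableOn_airyAi : IntegrableOn airyAi (Ioi 0) := by
  rw [← Ioc_union_Ioi_eq_Ioi zero_le_one]
  refine IntegrableOn.union
    ((continuous_airyAi.integrableOn_Icc (a := 0) (b := 1)).mono_set Ioc_subset_Icc_self) ?_
  have h := (integrableOn_Ioi_rpow_of_lt (a := -4) (by norm_num) zero_lt_one).const_mul 16
  refine Integrable.mono' h continuous_airyAi.aestronglyMeasurable ?_
  filter_upwards [ae_restrict_mem measurableSet_Ioi] with x hx
  have hx : 0 < x := one_pos.trans hx
  refine (abs_airyAi_le hx).trans_eq ?_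
  rw [Real.rpow_neg hx.le]
  norm_cast

/-! ### The integral of Ai over the half line -/

lemma integral_exp_neg_mul_cos {p : ℝ} (hp : 0 < p) (q : ℝ) :
    ∫ s in Ioi (0 : ℝ), Real.exp (-(p * s)) * Real.cos (q * s) = p / (p ^ 2 + q ^ 2) := by
  have hre : (⟨-p, q⟩ : ℂ).re < 0 := by simpa using hp
  have h := integral_exp_mul_complex_Ioi hre 0
  have hi := integrableOn_exp_mul_complex_Ioi hre 0
  have h2 := integral_re hi
  simp only [RCLike.re_eq_complex_re] at h2
  rw [h] at h2
  have h3 : ∫ s in Ioi (0 : ℝ), Real.exp (-(p * s)) * Real.cos (q * s)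
      = ∫ s in Ioi (0 : ℝ), (Complex.exp (⟨-p, q⟩ * s)).re := by
    refine setIntegral_congr_fun measurableSet_Ioi fun s _ => ?_
    simp [Complex.exp_re]
  rw [h3, h2]
  simp [Complex.div_re, Complex.normSq_apply]
  ring_nf

/-- The cosine transform is integrated over its frequency from 0 to q, with the order of integration
exchanged. -/
lemma integral_exp_neg_mul_sin_div {p : ℝ} (hp : 0 < p) (q : ℝ) :
    ∫ s in Ioi (0 : ℝ), Real.exp (-(p * s)) * Real.sin (q * s) / s = Real.arctan (q / p) := by
  have hint : Integrable (Function.uncurry fun t s : ℝ => Real.exp (-(p * s)) * Real.cos (t * s))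
      ((volume.restrict (uIoc 0 q)).prod (volume.restrict (Ioi 0))) := by
    have h0 := integrableOn_pow_mul_exp_neg_mul 0 hp
    simp only [pow_zero, one_mul] at h0
    have : IsFiniteMeasure (volume.restrict (uIoc 0 q)) :=
      ⟨by rw [Measure.restrict_apply_univ, uIoc]; exact measure_Ioc_lt_top⟩
    refine Integrable.mono' (Integrable.comp_snd h0 (volume.restrict (uIoc 0 q)))
      (Continuous.aestronglyMeasurable (by unfold Function.uncurry; fun_prop))
      (Filter.Eventually.of_forall fun z => ?_)
    rw [Function.uncurry, norm_mul, Real.norm_of_nonneg (Real.exp_pos _).le]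
    exact mul_le_of_le_one_right (Real.exp_pos _).le (Real.abs_cos_le_one _)
  have h := intervalIntegral_integral_swap hint
  have h1 : ∀ t : ℝ, HasDerivAt (fun t => Real.arctan (t / p)) (p / (p ^ 2 + t ^ 2)) t := by
    intro t
    refine (((hasDerivAt_id' t).div_const p).arctan).congr_deriv ?_
    field_simp
  simp only [integral_exp_neg_mul_cos hp] at h
  rw [intervalIntegral.integral_eq_sub_of_hasDerivAt (fun t _ => h1 t)
    (Continuous.intervalIntegrable (by fun_prop (disch := intros; positivity)) _ _)] at h
  simp only [zero_div, Real.arctan_zero, sub_zero] at h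
  rw [h]
  refine setIntegral_congr_fun measurableSet_Ioi fun s hs => ?_
  have hs : s ≠ 0 := (ne_of_gt hs)
  have h2 : ∀ t : ℝ, HasDerivAt (fun t => Real.exp (-(p * s)) * Real.sin (t * s) / s)
      (Real.exp (-(p * s)) * Real.cos (t * s)) t := by
    intro t
    refine (((((hasDerivAt_id' t).mul_const s).sin).const_mul _).div_const s).congr_deriv ?_
    field_simp
  rw [intervalIntegral.integral_eq_sub_of_hasDerivAt (fun t _ => h2 t)
    (Continuous.intervalIntegrable (by fun_prop) _ _)]
  simp

lemma abs_exp_neg_mul_sin_div_le (p q : ℝ) {s : ℝ} (hs : 0 < s) :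
    |Real.exp (-(p * s)) * Real.sin (q * s) / s| ≤ |q| * Real.exp (-(p * s)) := by
  rw [abs_div, abs_mul, abs_of_pos hs, abs_of_pos (Real.exp_pos _), div_le_iff₀ hs]
  have h : |Real.sin (q * s)| ≤ |q| * s := by
    refine Real.abs_sin_le_abs.trans_eq ?_
    rw [abs_mul, abs_of_pos hs]
  have := mul_le_mul_of_nonneg_left h (Real.exp_pos (-(p * s))).le
  linarith

lemma integrableOn_exp_neg_mul_sin_div {p : ℝ} (hp : 0 < p) (q : ℝ) :
    IntegrableOn (fun s => Real.exp (-(p * s)) * Real.sin (q * s) / s) (Ioi 0) := by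
  have h0 := (integrableOn_pow_mul_exp_neg_mul 0 hp).const_mul |q|
  simp only [pow_zero, one_mul] at h0
  refine Integrable.mono' h0 (Measurable.aestronglyMeasurable (by fun_prop)) ?_
  filter_upwards [ae_restrict_mem measurableSet_Ioi] with s hs
  exact abs_exp_neg_mul_sin_div_le p q hs

lemma sixthRoot_mul_airyKernel_im (x s : ℝ) : (sixthRoot * airyKernel 0 x s).im
    = Real.exp (-(s ^ 3 / 3)) * (Real.exp (-(x * s / 2)) *
      (√3 / 2 * Real.cos (√3 * x * s / 2) - Real.sin (√3 * x * s / 2) / 2)) := by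
  have h : airyKernel 0 x s = Complex.exp ⟨-(s ^ 3 / 3) - x * s / 2, -(√3 * x * s / 2)⟩ := by
    rw [airyKernel, pow_zero, one_mul]
    congr 1
    have h2 : -((s : ℂ) ^ 3 / 3 + x * sixthRoot * s)
      = ((-(s ^ 3 / 3) : ℝ) : ℂ) - ((x * s : ℝ) : ℂ) * sixthRoot := by
      push_cast
      ring
    rw [h2]
    apply Complex.ext
    · rw [Complex.sub_re, Complex.ofReal_re, Complex.re_ofReal_mul]
      simp only [sixthRoot]
      ring
    · rw [Complex.sub_im, Complex.ofReal_im, Complex.im_ofReal_mul]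
      simp only [sixthRoot]
      ring
  rw [h, Complex.mul_im, Complex.exp_re, Complex.exp_im, sub_eq_add_neg (-(s ^ 3 / 3)),
    Real.exp_add, Real.cos_neg, Real.sin_neg]
  simp only [sixthRoot]
  ring

lemma integral_airyAi_eq {X : ℝ} (hX : 0 ≤ X) :
    ∫ x in (0 : ℝ)..X, airyAi x = (∫ s in Ioi (0 : ℝ), Real.exp (-(s ^ 3 / 3)) *
      (Real.exp (-(X / 2 * s)) * Real.sin (√3 * X / 2 * s) / s)) / Real.pi := by
  have hAi : ∀ x, airyAi x
      = (∫ s in Ioi (0 : ℝ), (sixthRoot * airyKernel 0 x s).im) / Real.pi := by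
    intro x
    rw [airyAi_eq_im, airyMoment, ← integral_const_mul]
    congr 1
    exact (integral_im ((integrableOn_airyKernel 0 x).const_mul sixthRoot)).symm
  have hint : Integrable (Function.uncurry fun x s : ℝ => (sixthRoot * airyKernel 0 x s).im)
      ((volume.restrict (uIoc 0 X)).prod (volume.restrict (Ioi 0))) := by
    have h0 := integrableOn_pow_mul_exp_neg_cube 0 le_rfl
    simp only [pow_zero, one_mul, zero_mul, sub_zero] at h0
    have : IsFiniteMeasure (volume.restrict (uIoc 0 X)) :=
      ⟨by rw [Measure.restrict_apply_univ, uIoc]; exact measure_Ioc_lt_top⟩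
    refine Integrable.mono' (Integrable.comp_snd h0 (volume.restrict (uIoc 0 X)))
      (Continuous.aestronglyMeasurable (by unfold Function.uncurry airyKernel; fun_prop)) ?_
    rw [Measure.prod_restrict]
    filter_upwards [ae_restrict_mem (measurableSet_uIoc.prod measurableSet_Ioi)] with z hz
    obtain ⟨hz1, hz2⟩ := hz
    rw [uIoc_of_le hX] at hz1
    have hz1 : 0 < z.1 := hz1.1
    have hz2 : 0 < z.2 := hz2
    rw [Function.uncurry, Real.norm_eq_abs]
    refine (Complex.abs_im_le_norm _).trans ?_
    rw [norm_mul, norm_sixthRoot, one_mul, norm_airyKernel 0 _ hz2, pow_zero, one_mul]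
    apply Real.exp_le_exp.2
    have : 0 < z.1 * z.2 := mul_pos hz1 hz2
    linarith
  simp only [hAi, intervalIntegral.integral_div]
  rw [intervalIntegral_integral_swap hint]
  congr 1
  refine setIntegral_congr_fun measurableSet_Ioi fun s hs => ?_
  have hs : s ≠ 0 := (ne_of_gt hs)
  -- This x-primitive of the kernel vanishes at x = 0, so only the endpoint X contributes.
  have h2 : ∀ x : ℝ, HasDerivAt (fun x => Real.exp (-(s ^ 3 / 3)) *
      (Real.exp (-(x / 2 * s)) * Real.sin (√3 * x / 2 * s) / s))
      ((sixthRoot * airyKernel 0 x s).im) x := by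
    intro x
    have e1 := ((((hasDerivAt_id' x).div_const 2).mul_const s).neg).exp
    have e2 := (((((hasDerivAt_id' x).const_mul √3).div_const 2).mul_const s)).sin
    simp only [Pi.neg_apply] at e1
    refine (((e1.mul e2).div_const s).const_mul _).congr_deriv ?_
    rw [sixthRoot_mul_airyKernel_im, show x / 2 * s = x * s / 2 by ring,
      show √3 * x / 2 * s = √3 * x * s / 2 by ring]
    field_simp
    ring
  rw [intervalIntegral.integral_eq_sub_of_hasDerivAt (fun t _ => h2 t)
    (Continuous.intervalIntegrable (by unfold airyKernel; fun_prop) _ _)]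
  simp

/-- Without exp(-s³/3) the integral is arctan √3 = π/3 for every X. The error is controlled by 1 -
exp(-s³/3) ≤ s³/3 and |sin(qs)/s| ≤ |q|, and amounts to at most 16√3/X³ before division by π. -/
lemma abs_integral_airyAi_sub_le {X : ℝ} (hX : 0 < X) :
    |(∫ x in (0 : ℝ)..X, airyAi x) - 1 / 3| ≤ 16 / X ^ 3 := by
  have hX2 : 0 < X / 2 := by positivity
  have h1 := integral_exp_neg_mul_sin_div hX2 (√3 * X / 2)
  rw [show √3 * X / 2 / (X / 2) = √3 by field_simp, Real.arctan_sqrt_three] at h1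
  have hi := integrableOn_exp_neg_mul_sin_div hX2 (√3 * X / 2)
  have hi2 : IntegrableOn (fun s => Real.exp (-(s ^ 3 / 3)) *
      (Real.exp (-(X / 2 * s)) * Real.sin (√3 * X / 2 * s) / s)) (Ioi 0) := by
    refine Integrable.mono hi (Measurable.aestronglyMeasurable (by fun_prop)) ?_
    filter_upwards [ae_restrict_mem measurableSet_Ioi] with s hs
    have hs : 0 < s := hs
    rw [norm_mul, Real.norm_of_nonneg (Real.exp_pos _).le]
    refine mul_le_of_le_one_left (norm_nonneg _) (Real.exp_le_one_iff.2 ?_)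
    have : 0 < s ^ 3 := by positivity
    linarith
  have h3 : |(∫ s in Ioi (0 : ℝ), Real.exp (-(s ^ 3 / 3)) *
      (Real.exp (-(X / 2 * s)) * Real.sin (√3 * X / 2 * s) / s)) - Real.pi / 3|
      ≤ ∫ s in Ioi (0 : ℝ), √3 * X / 6 * (s ^ 3 * Real.exp (-(X / 2 * s))) := by
    rw [← h1, ← integral_sub hi2 hi, ← Real.norm_eq_abs]
    refine norm_integral_le_of_norm_le
      ((integrableOn_pow_mul_exp_neg_mul 3 hX2).const_mul _) ?_
    filter_upwards [ae_restrict_mem measurableSet_Ioi] with s hs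
    have hs : 0 < s := hs
    have h4 := abs_exp_neg_mul_sin_div_le (X / 2) (√3 * X / 2) hs
    rw [abs_of_pos (by positivity : 0 < √3 * X / 2)] at h4
    have h5 := Real.one_sub_le_exp_neg (s ^ 3 / 3)
    have h6 : Real.exp (-(s ^ 3 / 3)) ≤ 1 := Real.exp_le_one_iff.2 (by
      have : 0 < s ^ 3 := by positivity
      linarith)
    rw [← sub_one_mul, Real.norm_eq_abs, abs_mul, abs_of_nonpos (by linarith)]
    calc _ ≤ s ^ 3 / 3 * (√3 * X / 2 * Real.exp (-(X / 2 * s))) :=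
          mul_le_mul (by linarith) h4 (abs_nonneg _) (by positivity)
      _ = _ := by ring
  rw [integral_const_mul, integral_pow_mul_exp_neg_mul 3 hX2] at h3
  have hpi := Real.pi_gt_three
  have h7 : (∫ x in (0 : ℝ)..X, airyAi x) - 1 / 3 = ((∫ s in Ioi (0 : ℝ), Real.exp (-(s ^ 3 / 3)) *
      (Real.exp (-(X / 2 * s)) * Real.sin (√3 * X / 2 * s) / s)) - Real.pi / 3) / Real.pi := by
    rw [integral_airyAi_eq hX.le, sub_div, div_right_comm, div_self Real.pi_ne_zero]
  rw [h7, abs_div, abs_of_pos Real.pi_pos, div_le_iff₀ Real.pi_pos]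
  refine h3.trans ?_
  have h8 : √3 * X / 6 * (((3).factorial : ℝ) / (X / 2) ^ (3 + 1)) = 16 * √3 / X ^ 3 := by
    norm_num [Nat.factorial]
    field_simp
    norm_num
  rw [h8]
  rw [div_mul_eq_mul_div]
  gcongr
  exact (Real.sqrt_le_left Real.pi_pos.le).2 (by nlinarith)

lemma integral_airyAi : ∫ x in Ioi (0 : ℝ), airyAi x = 1 / 3 := by
  refine tendsto_nhds_unique
    (intervalIntegral_tendsto_integral_Ioi 0 integrableOn_airyAi Filter.tendsto_id) ?_
  rw [tendsto_iff_norm_sub_tendsto_zero]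
  refine squeeze_zero' (Filter.Eventually.of_forall fun _ => norm_nonneg _) ?_ (?_ :
    Filter.Tendsto (fun X : ℝ => 16 / X ^ 3) _ _)
  · filter_upwards [Filter.eventually_gt_atTop 0] with X hX
    exact abs_integral_airyAi_sub_le hX
  · exact Filter.Tendsto.div_atTop tendsto_const_nhds (Filter.tendsto_pow_atTop (by norm_num))

/-! ### The transforms I_k: derivatives and recurrence -/

lemma integrableOn_airyAi_div (k : ℕ) {a : ℝ} (ha : 0 < a) :
    IntegrableOn (fun x : ℝ => airyAi x / (x + a) ^ k) (Ioi 0) := by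
  refine Integrable.mono' (integrableOn_airyAi.norm.div_const (a ^ k))
    ((continuous_airyAi.measurable.div (by fun_prop)).aestronglyMeasurable) ?_
  filter_upwards [ae_restrict_mem measurableSet_Ioi] with x hx
  have hx : 0 < x := hx
  rw [norm_div, Real.norm_of_nonneg (by positivity : 0 ≤ (x + a) ^ k)]
  gcongr
  linarith

lemma hasDerivAt_airyStieltjes (k : ℕ) {a : ℝ} (ha : 0 < a) :
    HasDerivAt (airyStieltjes (k + 1)) (-((k : ℝ) + 1) * airyStieltjes (k + 2) a) a := by
  have h := hasDerivAt_integral_of_dominated_loc_of_deriv_le (μ := volume.restrict (Ioi (0 : ℝ)))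
    (F := fun a x => airyAi x / (x + a) ^ (k + 1))
    (F' := fun a x => -((k : ℝ) + 1) * (airyAi x / (x + a) ^ (k + 2))) (x₀ := a)
    -- Staying above a/2 keeps the denominators away from 0 uniformly in x.
    (s := Ioi (a / 2))
    (bound := fun x => ((k : ℝ) + 1) * (|airyAi x| / (a / 2) ^ (k + 2)))
    (Ioi_mem_nhds (by linarith))
    (Filter.Eventually.of_forall fun y =>
      (continuous_airyAi.measurable.div (by fun_prop)).aestronglyMeasurable)
    (integrableOn_airyAi_div _ ha)
    (((integrableOn_airyAi_div (k + 2) ha).const_mul _).aestronglyMeasurable) ?_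
    ((integrableOn_airyAi.norm.div_const _).const_mul _) ?_
  · refine h.2.congr_deriv ?_
    rw [integral_const_mul, airyStieltjes]
  · filter_upwards [ae_restrict_mem measurableSet_Ioi] with x hx y hy
    have hx : 0 < x := hx
    have hy : a / 2 < y := hy
    have hy0 : 0 < y := by linarith
    rw [norm_mul, norm_neg, norm_div, Real.norm_of_nonneg (by positivity : 0 ≤ (x + y) ^ (k + 2)),
      Real.norm_of_nonneg (by positivity : (0 : ℝ) ≤ k + 1), Real.norm_eq_abs]
    gcongr
    linarith
  · filter_upwards [ae_restrict_mem measurableSet_Ioi] with x hx y hy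
    have hx : 0 < x := hx
    have hy : a / 2 < y := hy
    have hxy : 0 < x + y := by linarith
    have h1 := (((hasDerivAt_id' y).const_add x).pow (k + 1)).inv (by simpa using by positivity)
    refine (h1.const_mul (airyAi x)).congr_deriv ?_
    simp
    field_simp
    ring

lemma hasDerivAt_deriv_airyStieltjes (k : ℕ) {a : ℝ} (ha : 0 < a) :
    HasDerivAt (deriv (airyStieltjes (k + 1)))
      (((k : ℝ) + 1) * ((k : ℝ) + 2) * airyStieltjes (k + 3) a) a := by
  have h := (hasDerivAt_airyStieltjes (k + 1) ha).const_mul (-((k : ℝ) + 1))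
  refine (h.congr_of_eventuallyEq ?_).congr_deriv ?_
  · filter_upwards [Ioi_mem_nhds ha] with b hb
    exact (hasDerivAt_airyStieltjes k hb).deriv
  · push_cast
    ring

lemma airyStieltjes_zero (a : ℝ) : airyStieltjes 0 a = 1 / 3 := by
  simp only [airyStieltjes, pow_zero, div_one, integral_airyAi]

lemma tendsto_airyAi_atTop : Filter.Tendsto airyAi Filter.atTop (nhds 0) := by
  refine squeeze_zero_norm' (a := fun x => 16 / x ^ 4) ?_
    (Filter.Tendsto.div_atTop tendsto_const_nhds (Filter.tendsto_pow_atTop (by norm_num)))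
  filter_upwards [Filter.eventually_gt_atTop 0] with x hx
  exact abs_airyAi_le hx

lemma tendsto_airyAi'_atTop : Filter.Tendsto airyAi' Filter.atTop (nhds 0) := by
  refine squeeze_zero_norm' (a := fun x => 4 / x ^ 2) ?_
    (Filter.Tendsto.div_atTop tendsto_const_nhds (Filter.tendsto_pow_atTop (by norm_num)))
  filter_upwards [Filter.eventually_gt_atTop 0] with x hx
  exact abs_airyAi'_le hx

lemma tendsto_inv_add_pow_atTop (a : ℝ) (n : ℕ) :
    Filter.Tendsto (fun x : ℝ => ((x + a) ^ (n + 1))⁻¹) Filter.atTop (nhds 0) :=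
  (((Filter.tendsto_pow_atTop (Nat.succ_ne_zero n)).comp
    (Filter.tendsto_atTop_add_const_right _ a Filter.tendsto_id))).inv_tendsto_atTop

lemma airyStieltjes_recurrence (k : ℕ) {a : ℝ} (ha : 0 < a) :
    airyStieltjes k a - a * airyStieltjes (k + 1) a
        - ((k : ℝ) + 1) * ((k : ℝ) + 2) * airyStieltjes (k + 3) a
      = -airyAi' 0 / a ^ (k + 1) - ((k : ℝ) + 1) * airyAi 0 / a ^ (k + 2) := by
  have i0 := integrableOn_airyAi_div k ha
  have i1 := (integrableOn_airyAi_div (k + 1) ha).const_mul a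
  have i01 : IntegrableOn (fun x => airyAi x / (x + a) ^ k - a * (airyAi x / (x + a) ^ (k + 1)))
      (Ioi 0) := i0.sub i1
  have i3 := (integrableOn_airyAi_div (k + 3) ha).const_mul (((k : ℝ) + 1) * ((k : ℝ) + 2))
  -- The two Ai' terms cancel; Ai'' = x·Ai with x = (x + a) - a supplies the first two terms of the
  -- derivative.
  have hd : ∀ x ∈ Ici (0 : ℝ), HasDerivAt
      (fun x => airyAi' x * ((x + a) ^ (k + 1))⁻¹
        + ((k : ℝ) + 1) * (airyAi x * ((x + a) ^ (k + 1 + 1))⁻¹))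
      (airyAi x / (x + a) ^ k - a * (airyAi x / (x + a) ^ (k + 1))
        - ((k : ℝ) + 1) * ((k : ℝ) + 2) * (airyAi x / (x + a) ^ (k + 3))) x := by
    intro x hx
    have hx : 0 ≤ x := hx
    have hxa : 0 < x + a := by linarith
    have e : ∀ n : ℕ, HasDerivAt (fun x : ℝ => ((x + a) ^ (n + 1))⁻¹)
        (-((n : ℝ) + 1) / (x + a) ^ (n + 2)) x := by
      intro n
      have h1 := (((hasDerivAt_id' x).add_const a).pow (n + 1)).inv
        (by simpa using by positivity)
      refine h1.congr_deriv ?_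
      simp
      field_simp
      ring
    refine (((hasDerivAt_airyAi' x).mul (e k)).add
      (((hasDerivAt_airyAi x).mul (e (k + 1))).const_mul _)).congr_deriv ?_
    push_cast
    field_simp
    ring
  have ht := (tendsto_airyAi'_atTop.mul (tendsto_inv_add_pow_atTop a k)).add
    ((tendsto_airyAi_atTop.mul (tendsto_inv_add_pow_atTop a (k + 1))).const_mul ((k : ℝ) + 1))
  have h := integral_Ioi_of_hasDerivAt_of_tendsto' hd (i01.sub i3) ht
  rw [integral_sub i01 i3, integral_sub i0 i1, integral_const_mul,
    integral_const_mul] at h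
  rw [airyStieltjes, airyStieltjes, airyStieltjes, h]
  simp only [zero_add]
  ring

/-! ### Variation of parameters and the equation for I_1 -/

/-- Variation of parameters for `y'' + a y = R` on the positive half line, where `u`, `v` solve
`z'' = x z` and have Wronskian `w`. -/
lemma airy_variation_of_parameters {u u' v v' y y' R P Q : ℝ → ℝ} {w : ℝ}
    (hu : ∀ x, HasDerivAt u (u' x) x) (hu' : ∀ x, HasDerivAt u' (x * u x) x)
    (hv : ∀ x, HasDerivAt v (v' x) x) (hv' : ∀ x, HasDerivAt v' (x * v x) x)
    (hw : ∀ x, u x * v' x - u' x * v x = w)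
    (hy : ∀ a, 0 < a → HasDerivAt y (y' a) a)
    (hy' : ∀ a, 0 < a → HasDerivAt y' (R a - a * y a) a)
    (hP : ∀ a, 0 < a → HasDerivAt P (R a * u (-a)) a)
    (hQ : ∀ a, 0 < a → HasDerivAt Q (R a * v (-a)) a) {a₀ a : ℝ} (ha₀ : 0 < a₀) (ha : 0 < a) :
    w * y a = (-(y a₀ * u' (-a₀)) - y' a₀ * u (-a₀) - (P a - P a₀)) * v (-a)
      + (y a₀ * v' (-a₀) + y' a₀ * v (-a₀) + (Q a - Q a₀)) * u (-a) := by
  have key : ∀ f f' S : ℝ → ℝ, (∀ x, HasDerivAt f (f' x) x) →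
      (∀ x, HasDerivAt f' (x * f x) x) → (∀ a, 0 < a → HasDerivAt S (R a * f (-a)) a) →
      -(y a * f' (-a)) - y' a * f (-a) + S a = -(y a₀ * f' (-a₀)) - y' a₀ * f (-a₀) + S a₀ := by
    intro f f' S hf hf' hS
    have hd : ∀ b, 0 < b →
        HasDerivAt (fun b => -(y b * f' (-b)) - y' b * f (-b) + S b) 0 b := by
      intro b hb
      have e1 := (hf (-b)).comp b (hasDerivAt_neg b)
      have e2 := (hf' (-b)).comp b (hasDerivAt_neg b)
      refine ((((hy b hb).mul e2).neg.sub ((hy' b hb).mul e1)).add (hS b hb)).congr_deriv ?_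
      simp only [Function.comp_apply]
      ring
    exact isOpen_Ioi.is_const_of_deriv_eq_zero isPreconnected_Ioi
      (fun b hb => (hd b hb).differentiableAt.differentiableWithinAt)
      (fun b hb => (hd b hb).deriv) ha ha₀
  have h1 := key u u' P hu hu' hP
  have h2 := key v v' Q hv hv' hQ
  -- Eliminating y'(a) between the two conserved quantities leaves y(a) times the Wronskian.
  linear_combination v (-a) * h1 - u (-a) * h2 - y a * hw (-a)

/-- The right-hand side of the differential equation for `airyStieltjes 1`. -/
noncomputable def airyStieltjesSource (a : ℝ) : ℝ := 1 / 3 + airyAi' 0 / a + airyAi 0 / a ^ 2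

lemma airyStieltjes_succ_ode (k : ℕ) {a : ℝ} (ha : 0 < a) :
    deriv (deriv (airyStieltjes (k + 1))) a + a * airyStieltjes (k + 1) a
      = airyStieltjes k a + airyAi' 0 / a ^ (k + 1) + ((k : ℝ) + 1) * airyAi 0 / a ^ (k + 2) := by
  rw [(hasDerivAt_deriv_airyStieltjes k ha).deriv]
  linear_combination -airyStieltjes_recurrence k ha

lemma airyStieltjes_one_ode {a : ℝ} (ha : 0 < a) :
    deriv (deriv (airyStieltjes 1)) a + a * airyStieltjes 1 a = airyStieltjesSource a := by
  have h := airyStieltjes_succ_ode 0 ha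
  rw [airyStieltjes_zero] at h
  simpa [airyStieltjesSource] using h

lemma hasDerivAt_airyStieltjes_one {a : ℝ} (ha : 0 < a) :
    HasDerivAt (airyStieltjes 1) (-airyStieltjes 2 a) a := by
  simpa using hasDerivAt_airyStieltjes 0 ha

lemma hasDerivAt_neg_airyStieltjes_two {a : ℝ} (ha : 0 < a) :
    HasDerivAt (fun a => -airyStieltjes 2 a) (airyStieltjesSource a - a * airyStieltjes 1 a) a := by
  have h := hasDerivAt_deriv_airyStieltjes 0 ha
  rw [← airyStieltjes_one_ode ha, add_sub_cancel_right]
  refine (h.congr_of_eventuallyEq ?_).congr_deriv h.deriv.symm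
  filter_upwards [Ioi_mem_nhds ha] with b hb
  exact (hasDerivAt_airyStieltjes_one hb).deriv.symm

/-! ### Normalising the constants -/

lemma rpow_third_pow_three : ((3 : ℝ) ^ (1 / 3 : ℝ)) ^ 3 = 3 := by
  rw [← Real.rpow_natCast, ← Real.rpow_mul (by norm_num)]
  norm_num

/-- Powers of `3` with exponents in `(1/6)ℤ` in terms of `√3` and the cube root of `3`. -/
lemma rpow_three_eq (i j : ℕ) {r : ℝ} (h : r = i / 2 + j / 3) :
    (3 : ℝ) ^ r = √3 ^ i * ((3 : ℝ) ^ (1 / 3 : ℝ)) ^ j := by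
  rw [Real.sqrt_eq_rpow, ← Real.rpow_natCast, ← Real.rpow_natCast, ← Real.rpow_mul (by norm_num),
    ← Real.rpow_mul (by norm_num), ← Real.rpow_add (by norm_num), h]
  congr 1
  ring

/-- All constants are written in √3, 3^(1/3), π and Γ(2/3), so later identities are algebraic modulo
(√3)² = 3 and (3^(1/3))³ = 3. -/
lemma airyC₁_eq : airyC₁ = (3 : ℝ) ^ (1 / 3 : ℝ) / (3 * Real.Gamma (2 / 3)) := by
  rw [airyC₁, show (-(2 / 3) : ℝ) = 1 / 3 - 1 by norm_num, Real.rpow_sub_one (by norm_num)]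
  field_simp

lemma airyC₂_eq : airyC₂ = √3 * ((3 : ℝ) ^ (1 / 3 : ℝ)) ^ 2 * Real.Gamma (2 / 3)
    / (6 * Real.pi) := by
  have h := rpow_three_eq 0 2 (r := 2 / 3) (by norm_num)
  have := gamma_two_thirds_pos
  have := Real.pi_pos
  rw [airyC₂, show (-(1 / 3) : ℝ) = 2 / 3 - 1 by norm_num, Real.rpow_sub_one (by norm_num), h,
    gamma_one_third]
  field_simp
  ring

lemma airyStieltjesSource_eq (a : ℝ) : airyStieltjesSource a = 1 / 3 +
    (-((3 : ℝ) ^ (1 / 6 : ℝ) / 2) * (Real.Gamma (2 / 3) / a)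
      + Real.pi / ((3 : ℝ) ^ (2 / 3 : ℝ) * Real.Gamma (2 / 3) * a ^ 2)) / Real.pi := by
  have h1 := rpow_three_eq 1 2 (r := 7 / 6) (by norm_num)
  have h2 := rpow_three_eq 0 2 (r := 2 / 3) (by norm_num)
  rw [show (7 / 6 : ℝ) = 1 / 6 + 1 by norm_num, Real.rpow_add_one (by norm_num)] at h1
  have h3 : (3 : ℝ) ^ (1 / 6 : ℝ) = √3 * ((3 : ℝ) ^ (1 / 3 : ℝ)) ^ 2 / 3 := by
    linear_combination h1 / 3
  have ht := rpow_third_pow_three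
  rw [airyStieltjesSource, airyAi_zero, airyAi'_zero, airyC₁_eq, airyC₂_eq, h2, h3]
  have htp : 0 < (3 : ℝ) ^ (1 / 3 : ℝ) := by positivity
  generalize (3 : ℝ) ^ (1 / 3 : ℝ) = t at *
  have := gamma_two_thirds_pos
  have := Real.pi_pos
  rcases eq_or_ne a 0 with rfl | ha
  · simp
  · field_simp
    linear_combination 12 * Real.pi * ht

/-! ### Hypergeometric antiderivatives -/

lemma hypergeometric_one_two_eq (q b c w : ℝ) : hypergeometricPFQ [q] [b, c] w
    = seriesEval (fun n => rising q n / (rising b n * rising c n) / n.factorial) w := by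
  refine tsum_congr fun n => ?_
  simp [rising]
  ring

lemma hypergeometric_two_three_eq (b w : ℝ) : hypergeometricPFQ [1, 1] [2, 2, b] w
    = seriesEval (fun n => 1 / ((n : ℝ) + 1) ^ 2 * zeroFOneCoeff b n) w := by
  refine tsum_congr fun n => ?_
  have h1 := rising_one n
  have h2 := rising_two n
  rw [Nat.factorial_succ] at h2
  push_cast at h2
  simp only [rising] at h1 h2
  simp only [List.map_cons, List.map_nil, List.prod_cons, List.prod_nil, zeroFOneCoeff, rising,
    mul_one]
  rw [h1, h2]
  have : (0 : ℝ) < n.factorial := by positivity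
  field_simp

/-- With q = m/3 and c = q + 1, the ratio (q)_n/(c)_n is m/(m + 3n), exactly what a·d/da cancels; a
0F1 series remains. -/
lemma hasDerivAt_zpow_mul_hypergeometric_one_two {m : ℤ} (hm : ¬ (3 : ℤ) ∣ m) {q b c : ℝ}
    (hq : q = m / 3) (hc : c = q + 1) (hc0 : 0 < c) (hb : 0 < b) {a : ℝ} (ha : a ≠ 0) :
    HasDerivAt (fun a => a ^ m * hypergeometricPFQ [q] [b, c] (-a ^ 3 / 9))
      (m * a ^ (m - 1) * zeroFOne b (-a ^ 3 / 9)) a := by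
  have hd : ∀ n : ℕ, ((m : ℝ) + 3 * n) * (rising q n / (rising b n * rising c n) / n.factorial)
      = m * zeroFOneCoeff b n := by
    intro n
    have h1 := rising_mul_add q n
    have h2 := rising_pos hb n
    have h3 := rising_pos hc0 n
    have hm3 : (m : ℝ) = 3 * q := by rw [hq]; ring
    have : (0 : ℝ) < n.factorial := by positivity
    rw [← hc] at h1
    rw [zeroFOneCoeff, hm3]
    field_simp
    linear_combination h1
  have he := ((entireCoeff_zeroFOneCoeff hb).const_mul (m : ℝ)).of_linear_mul m hm hd
  simp only [hypergeometric_one_two_eq]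
  refine (he.hasDerivAt_zpow_mul m hd ha).congr_deriv ?_
  rw [seriesEval_const_mul, zeroFOne]
  ring

/-- Here (1)_n²/(2)_n² = 1/(n+1)². Differentiation cancels one factor n + 1; the other shifts the
index, leaving the 0F1 series without its constant term. That missing term is what later produces
the logarithm. -/
lemma hasDerivAt_cube_mul_hypergeometric_two_three {b c : ℝ} (hb : 0 < b) (hc : c = b + 1) {a : ℝ}
    (ha : a ≠ 0) :
    HasDerivAt (fun a => a ^ 3 * hypergeometricPFQ [1, 1] [2, 2, c] (-a ^ 3 / 9))
      (-(27 * b) * ((zeroFOne b (-a ^ 3 / 9) - 1) / a)) a := by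
  have hc0 : 0 < c := by linarith
  have he : EntireCoeff fun n => 1 / ((n : ℝ) + 1) ^ 2 * zeroFOneCoeff c n := by
    refine (entireCoeff_zeroFOneCoeff hc0).of_le fun n => ?_
    rw [abs_mul, abs_of_pos (by positivity)]
    refine mul_le_of_le_one_left (abs_nonneg _) ((div_le_one (by positivity)).2 ?_)
    nlinarith [n.cast_nonneg (α := ℝ)]
  have hd : ∀ n : ℕ, (((3 : ℤ) : ℝ) + 3 * n) * (1 / ((n : ℝ) + 1) ^ 2 * zeroFOneCoeff c n)
      = 3 * b * zeroFOneCoeff b (n + 1) := by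
    intro n
    have h := zeroFOneCoeff_succ hb n
    rw [← hc] at h
    have h2 : zeroFOneCoeff c n = b * (((n : ℝ) + 1) * zeroFOneCoeff b (n + 1)) := by
      rw [h]
      field_simp
    rw [h2]
    push_cast
    field_simp
    ring
  have h1 := (entireCoeff_zeroFOneCoeff hb).seriesEval_eq_add (-a ^ 3 / 9)
  have h2 := he.hasDerivAt_zpow_mul 3 hd ha
  simp only [hypergeometric_two_three_eq]
  refine h2.congr_deriv ?_
  rw [seriesEval_const_mul, zeroFOne, h1]
  simp [zeroFOneCoeff, rising_zero]
  norm_cast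
  field_simp
  ring

lemma airyF_neg (a : ℝ) : airyF (-a) = zeroFOne (2 / 3) (-a ^ 3 / 9) := by
  rw [airyF_eq, Odd.neg_pow (by decide)]

lemma airyG_neg (a : ℝ) : airyG (-a) = -a * zeroFOne (4 / 3) (-a ^ 3 / 9) := by
  rw [airyG_eq, Odd.neg_pow (by decide)]

/-- The three series integrate the three terms of the source times `airyG`; the logarithm integrates
the leading -Ai(0)/a. -/
lemma hasDerivAt_airyHPlus {a : ℝ} (ha : 0 < a) :
    HasDerivAt (fun a => 2 * √3 * airyC₁ * airyHPlus a - airyC₁ * Real.log a)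
      (airyStieltjesSource a * airyG (-a)) a := by
  have h1 := hasDerivAt_zpow_mul_hypergeometric_one_two (m := 1) (q := 1 / 3) (b := 4 / 3)
    (c := 4 / 3) (by norm_num) (by norm_num) (by norm_num) (by norm_num) (by norm_num) ha.ne'
  have h2 := hasDerivAt_zpow_mul_hypergeometric_one_two (m := 2) (q := 2 / 3) (b := 4 / 3)
    (c := 5 / 3) (by norm_num) (by norm_num) (by norm_num) (by norm_num) (by norm_num) ha.ne'
  have h3 := hasDerivAt_cube_mul_hypergeometric_two_three (b := 4 / 3) (c := 7 / 3)
    (by norm_num) (by norm_num) ha.ne'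
  have h := ((((h1.const_mul ((3 : ℝ) ^ (1 / 3 : ℝ) * Real.Gamma (2 / 3) ^ 2
    / (4 * Real.pi))).sub (h2.const_mul (Real.Gamma (2 / 3) / ((3 : ℝ) ^ (5 / 6 : ℝ) * 4)))).add
    (h3.const_mul (√3 / 216))).const_mul (2 * √3 * airyC₁)).sub
    ((Real.hasDerivAt_log ha.ne').const_mul airyC₁)
  refine (h.congr_of_eventuallyEq (Filter.Eventually.of_forall fun x => ?_)).congr_deriv ?_
  · simp only [airyHPlus, Pi.sub_apply, Pi.add_apply, zpow_one]
    norm_cast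
    ring
  · have e := rpow_three_eq 1 1 (r := 5 / 6) (by norm_num)
    have ht := rpow_third_pow_three
    rw [airyStieltjesSource, airyAi_zero, airyAi'_zero, airyG_neg, airyC₁_eq, airyC₂_eq, e]
    have hs : √3 ^ 2 = 3 := Real.sq_sqrt (by norm_num)
    have hsp : 0 < √3 := by positivity
    have htp : 0 < (3 : ℝ) ^ (1 / 3 : ℝ) := by positivity
    generalize (3 : ℝ) ^ (1 / 3 : ℝ) = t at *
    generalize √3 = s at *
    have := gamma_two_thirds_pos
    have := Real.pi_pos
    generalize zeroFOne (4 / 3) (-a ^ 3 / 9) = E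
    norm_num
    field_simp
    linear_combination (-1728 * t * Real.pi * (E - 1)) * hs

lemma hasDerivAt_airyHMinus {a : ℝ} (ha : 0 < a) :
    HasDerivAt (fun a => 2 * √3 * airyC₂ * airyHMinus a - airyC₂ * Real.log a)
      (airyStieltjesSource a * airyF (-a)) a := by
  have h1 := hasDerivAt_zpow_mul_hypergeometric_one_two (m := -1) (q := -(1 / 3)) (b := 2 / 3)
    (c := 2 / 3) (by norm_num) (by norm_num) (by norm_num) (by norm_num) (by norm_num) ha.ne'
  have h2 := hasDerivAt_zpow_mul_hypergeometric_one_two (m := 1) (q := 1 / 3) (b := 2 / 3)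
    (c := 4 / 3) (by norm_num) (by norm_num) (by norm_num) (by norm_num) (by norm_num) ha.ne'
  have h3 := hasDerivAt_cube_mul_hypergeometric_two_three (b := 2 / 3) (c := 5 / 3)
    (by norm_num) (by norm_num) ha.ne'
  have h := ((((h1.const_mul (-(Real.pi / ((3 : ℝ) ^ (4 / 3 : ℝ) * Real.Gamma (2 / 3) ^ 2)))).add
    (h2.const_mul (Real.Gamma (1 / 3) / ((3 : ℝ) ^ (7 / 6 : ℝ) * 2)))).add
    (h3.const_mul (√3 / 108))).const_mul (2 * √3 * airyC₂)).sub
    ((Real.hasDerivAt_log ha.ne').const_mul airyC₂)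
  refine (h.congr_of_eventuallyEq (Filter.Eventually.of_forall fun x => ?_)).congr_deriv ?_
  · simp only [airyHMinus, Pi.sub_apply, Pi.add_apply, zpow_one, zpow_neg_one, one_div]
    ring
  · have e1 := rpow_three_eq 0 4 (r := 4 / 3) (by norm_num)
    have e2 := rpow_three_eq 1 2 (r := 7 / 6) (by norm_num)
    have ht := rpow_third_pow_three
    rw [airyStieltjesSource, airyAi_zero, airyAi'_zero, airyF_neg, airyC₁_eq, airyC₂_eq, e1, e2,
      gamma_one_third]
    have hs : √3 ^ 2 = 3 := Real.sq_sqrt (by norm_num)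
    have hsp : 0 < √3 := by positivity
    have htp : 0 < (3 : ℝ) ^ (1 / 3 : ℝ) := by positivity
    generalize (3 : ℝ) ^ (1 / 3 : ℝ) = t at *
    generalize √3 = s at *
    have := gamma_two_thirds_pos
    have := Real.pi_pos
    generalize zeroFOne (2 / 3) (-a ^ 3 / 9) = E
    norm_num
    field_simp
    linear_combination (648 * Real.pi * E
      - 108 * s * t ^ 4 * Real.Gamma (2 / 3) ^ 2 * a * (E - 1)) * hs - 648 * Real.pi * E * ht

/-! ### The two solution formulas for I_1 -/

lemma airyStieltjes_one_closed_form {a₀ a : ℝ} (ha₀ : 0 < a₀) (ha : 0 < a) :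
    airyStieltjes 1 a
      = Real.pi / (2 * √3) * airyStieltjes 1 a₀ *
          (airyJMinus a * airyJPlus' a₀ - airyJPlus a * airyJMinus' a₀)
        - Real.pi / (2 * √3) * airyStieltjes 2 a₀ *
          (airyJMinus a * airyJPlus a₀ - airyJPlus a * airyJMinus a₀)
        + airyJPlus a * (airyHPlus a - airyHPlus a₀)
        + airyJMinus a * (airyHMinus a - airyHMinus a₀)
        - airyAi (-a) * (Real.log a - Real.log a₀) := by
  -- The logarithms in the two primitives recombine, with coefficients `airyC₁` and `airyC₂`, into
  -- the single term with Ai(-a).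
  have h := airy_variation_of_parameters hasDerivAt_airyF hasDerivAt_airyF' hasDerivAt_airyG
    hasDerivAt_airyG' airyFG_wronskian (fun _ => hasDerivAt_airyStieltjes_one)
    (fun _ => hasDerivAt_neg_airyStieltjes_two) (fun _ => hasDerivAt_airyHMinus)
    (fun _ => hasDerivAt_airyHPlus) ha₀ ha
  have hc : 12 * (airyC₁ * airyC₂) * (Real.pi / (2 * √3)) = 1 := by
    rw [airyC_mul]
    have := Real.pi_pos
    field_simp
    norm_num
  have p : ∀ x, airyJPlus x = 2 * √3 * airyC₁ * airyF (-x) := fun x => by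
    rw [airyJPlus, airyAi, airyBi]; ring
  have m : ∀ x, airyJMinus x = -(2 * √3 * airyC₂ * airyG (-x)) := fun x => by
    rw [airyJMinus, airyAi, airyBi]; ring
  have p' : ∀ x, airyJPlus' x = 2 * √3 * airyC₁ * airyF' (-x) := fun x => by
    rw [airyJPlus', deriv_airyAi, deriv_airyBi, airyAi', airyBi']; ring
  have m' : ∀ x, airyJMinus' x = -(2 * √3 * airyC₂ * airyG' (-x)) := fun x => by
    rw [airyJMinus', deriv_airyAi, deriv_airyBi, airyAi', airyBi']; ring
  have hs : √3 ^ 2 = 3 := Real.sq_sqrt (by norm_num)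
  rw [one_mul] at h
  rw [h, p, m, p, m, p', m', airyAi]
  set X := airyStieltjes 1 a₀ * (airyG' (-a₀) * airyF (-a) - airyF' (-a₀) * airyG (-a))
    - airyStieltjes 2 a₀ * (airyG (-a₀) * airyF (-a) - airyF (-a₀) * airyG (-a)) with hX
  linear_combination (-X) * hc - 4 * airyC₁ * airyC₂ * (Real.pi / (2 * √3)) * X * hs

lemma airyStieltjes_one_variation_of_parameters {a₀ a : ℝ} (ha₀ : 0 < a₀) (ha : 0 < a) :
    airyStieltjes 1 a
      = Real.pi * airyStieltjes 1 a₀ *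
          (airyAi (-a) * airyBi' (-a₀) - airyBi (-a) * airyAi' (-a₀))
        - Real.pi * airyStieltjes 2 a₀ *
          (airyAi (-a) * airyBi (-a₀) - airyBi (-a) * airyAi (-a₀))
        + Real.pi / 3 *
          (airyAi (-a) * (∫ z in a₀..a, airyBi (-z)) - airyBi (-a) * ∫ z in a₀..a, airyAi (-z))
        + airyAi (-a) * (∫ z in a₀..a,
            (-((3 : ℝ) ^ (1 / 6 : ℝ) / 2) * (Real.Gamma (2 / 3) / z)
              + Real.pi / ((3 : ℝ) ^ (2 / 3 : ℝ) * Real.Gamma (2 / 3) * z ^ 2)) * airyBi (-z))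
        - airyBi (-a) * ∫ z in a₀..a,
            (-((3 : ℝ) ^ (1 / 6 : ℝ) / 2) * (Real.Gamma (2 / 3) / z)
              + Real.pi / ((3 : ℝ) ^ (2 / 3 : ℝ) * Real.Gamma (2 / 3) * z ^ 2)) * airyAi (-z) := by
  set r : ℝ → ℝ := fun z => -((3 : ℝ) ^ (1 / 6 : ℝ) / 2) * (Real.Gamma (2 / 3) / z)
    + Real.pi / ((3 : ℝ) ^ (2 / 3 : ℝ) * Real.Gamma (2 / 3) * z ^ 2) with hr
  have hg := gamma_two_thirds_pos
  have hrc : ContinuousOn r (Ioi 0) := by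
    intro z hz
    have hz : z ≠ 0 := ne_of_gt hz
    apply ContinuousAt.continuousWithinAt
    have : (3 : ℝ) ^ (2 / 3 : ℝ) * Real.Gamma (2 / 3) * z ^ 2 ≠ 0 := by positivity
    fun_prop (disch := assumption)
  -- Whichever endpoint is larger, the interval avoids the pole of r at 0.
  have hsub : ∀ b, 0 < b → uIcc a₀ b ⊆ Ioi 0 := fun b hb z hz =>
    (lt_min ha₀ hb).trans_le hz.1
  -- The source is 1/3 + r/π; the Wronskian 1/π of Ai and Bi later clears this π.
  have prim : ∀ f : ℝ → ℝ, Continuous f → ∀ b, 0 < b →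
      HasDerivAt (fun b => 1 / 3 * (∫ z in a₀..b, f (-z)) + 1 / Real.pi * ∫ z in a₀..b, r z * f (-z))
        (airyStieltjesSource b * f (-b)) b := by
    intro f hf b hb
    have hf' : Continuous fun z => f (-z) := hf.comp continuous_neg
    have hrf : ContinuousOn (fun z => r z * f (-z)) (Ioi 0) := hrc.mul hf'.continuousOn
    have d1 := intervalIntegral.integral_hasDerivAt_right (hf'.intervalIntegrable a₀ b)
      hf'.stronglyMeasurable.stronglyMeasurableAtFilter hf'.continuousAt
    have d2 := intervalIntegral.integral_hasDerivAt_right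
      ((hrf.mono (hsub b hb)).intervalIntegrable)
      (hrf.stronglyMeasurableAtFilter isOpen_Ioi b hb) (hrf.continuousAt (Ioi_mem_nhds hb))
    refine ((d1.const_mul (1 / 3)).add (d2.const_mul (1 / Real.pi))).congr_deriv ?_
    rw [airyStieltjesSource_eq]
    simp only [hr]
    ring
  have h := airy_variation_of_parameters hasDerivAt_airyAi hasDerivAt_airyAi' hasDerivAt_airyBi
    hasDerivAt_airyBi' airyAi_airyBi_wronskian (fun _ => hasDerivAt_airyStieltjes_one)
    (fun _ => hasDerivAt_neg_airyStieltjes_two) (prim _ continuous_airyAi)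
    (prim _ continuous_airyBi) ha₀ ha
  simp only [intervalIntegral.integral_same] at h
  have hpi := Real.pi_pos
  rw [div_mul_eq_mul_div, one_mul, div_eq_iff hpi.ne'] at h
  simp only [hr] at h
  rw [h]
  generalize (∫ z in a₀..a, (-((3 : ℝ) ^ (1 / 6 : ℝ) / 2) * (Real.Gamma (2 / 3) / z)
    + Real.pi / ((3 : ℝ) ^ (2 / 3 : ℝ) * Real.Gamma (2 / 3) * z ^ 2)) * airyAi (-z)) = A
  generalize (∫ z in a₀..a, (-((3 : ℝ) ^ (1 / 6 : ℝ) / 2) * (Real.Gamma (2 / 3) / z)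
    + Real.pi / ((3 : ℝ) ^ (2 / 3 : ℝ) * Real.Gamma (2 / 3) * z ^ 2)) * airyBi (-z)) = B
  field_simp
  ring

theorem mainTheorem3 :
    -- the integrals converge
    (∀ (k : ℕ) (a : ℝ), 0 < a →
      IntegrableOn (fun x : ℝ => airyAi x / (x + a) ^ k) (Ioi 0)) ∧
    -- the recurrence
    (∀ (k : ℕ) (a : ℝ), 0 < a →
      airyStieltjes k a - a * airyStieltjes (k + 1) a
          - ((k : ℝ) + 1) * ((k : ℝ) + 2) * airyStieltjes (k + 3) a
        = -deriv airyAi 0 / a ^ (k + 1) - ((k : ℝ) + 1) * airyAi 0 / a ^ (k + 2)) ∧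
    -- the differential relations
    (∀ (k : ℕ) (a : ℝ), 0 < a →
      HasDerivAt (airyStieltjes (k + 1)) (-((k : ℝ) + 1) * airyStieltjes (k + 2) a) a ∧
      HasDerivAt (deriv (airyStieltjes (k + 1)))
        (((k : ℝ) + 1) * ((k : ℝ) + 2) * airyStieltjes (k + 3) a) a) ∧
    -- the differential equation for `I_{k+1}`
    (∀ (k : ℕ) (a : ℝ), 0 < a →
      deriv (deriv (airyStieltjes (k + 1))) a + a * airyStieltjes (k + 1) a
        = airyStieltjes k a + deriv airyAi 0 / a ^ (k + 1)
          + ((k : ℝ) + 1) * airyAi 0 / a ^ (k + 2)) ∧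
    -- the value of `I_0`
    (∀ a : ℝ, 0 < a → airyStieltjes 0 a = 1 / 3) ∧
    -- the differential equation for `I_1`
    (∀ a : ℝ, 0 < a →
      deriv (deriv (airyStieltjes 1)) a + a * airyStieltjes 1 a
        = 1 / 3 + deriv airyAi 0 / a + airyAi 0 / a ^ 2) ∧
    -- the solution by variation of parameters
    (∀ a₀ a : ℝ, 0 < a₀ → 0 < a →
      airyStieltjes 1 a
        = Real.pi * airyStieltjes 1 a₀ *
            (airyAi (-a) * deriv airyBi (-a₀) - airyBi (-a) * deriv airyAi (-a₀))
          - Real.pi * airyStieltjes 2 a₀ *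
            (airyAi (-a) * airyBi (-a₀) - airyBi (-a) * airyAi (-a₀))
          + Real.pi / 3 *
            (airyAi (-a) * (∫ z in a₀..a, airyBi (-z)) - airyBi (-a) * ∫ z in a₀..a, airyAi (-z))
          + airyAi (-a) * (∫ z in a₀..a,
              (-((3 : ℝ) ^ (1 / 6 : ℝ) / 2) * (Real.Gamma (2 / 3) / z)
                + Real.pi / ((3 : ℝ) ^ (2 / 3 : ℝ) * Real.Gamma (2 / 3) * z ^ 2)) * airyBi (-z))
          - airyBi (-a) * ∫ z in a₀..a,
              (-((3 : ℝ) ^ (1 / 6 : ℝ) / 2) * (Real.Gamma (2 / 3) / z)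
                + Real.pi / ((3 : ℝ) ^ (2 / 3 : ℝ) * Real.Gamma (2 / 3) * z ^ 2)) * airyAi (-z)) ∧
    -- the closed form
    (∀ a₀ a : ℝ, 0 < a₀ → 0 < a →
      airyStieltjes 1 a
        = Real.pi / (2 * √3) * airyStieltjes 1 a₀ *
            (airyJMinus a * airyJPlus' a₀ - airyJPlus a * airyJMinus' a₀)
          - Real.pi / (2 * √3) * airyStieltjes 2 a₀ *
            (airyJMinus a * airyJPlus a₀ - airyJPlus a * airyJMinus a₀)
          + airyJPlus a * (airyHPlus a - airyHPlus a₀)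
          + airyJMinus a * (airyHMinus a - airyHMinus a₀)
          - airyAi (-a) * (Real.log a - Real.log a₀)) := by
  refine ⟨fun k a => integrableOn_airyAi_div k, fun k a ha => ?_,
    fun k a ha => ⟨hasDerivAt_airyStieltjes k ha, hasDerivAt_deriv_airyStieltjes k ha⟩,
    fun k a ha => ?_, fun a _ => airyStieltjes_zero a, fun a ha => ?_, fun a₀ a ha₀ ha => ?_,
    fun a₀ a => airyStieltjes_one_closed_form⟩
  · rw [deriv_airyAi]
    exact airyStieltjes_recurrence k ha
  · rw [deriv_airyAi]
    exact airyStieltjes_succ_ode k ha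
  · rw [deriv_airyAi]
    exact airyStieltjes_one_ode ha
  · rw [deriv_airyAi, deriv_airyBi]
    exact airyStieltjes_one_variation_of_parameters ha₀ ha
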